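/- Let $R=\mathbb Z[\lambda^{\pm1},\mu^{\pm1}]$. For $n\ge 1$ let $B_n$ be the braid group on $n$ strands, with Artin generators $\sigma_1,\dots,\sigma_{n-1}$, and let $\mathcal A_n$ be the tensor (free associative unital) algebra over $R[U,V]$ on the generators $a_{ij}$, $1\le i,j\le n$, $i\ne j$. Let $\phi:B_n\to\operatorname{Aut}\mathcal A_n$, $B\mapsto\phi_B$, be the homomorphism of groups given by \[ \phi_{\sigma_k}:\quad \begin{cases} a_{ki}\mapsto -a_{k+1,i}-a_{k+1,k}a_{ki}, & i\ne k,k+1,\\ a_{ik}\mapsto -a_{i,k+1}-a_{ik}a_{k,k+1}, & i\ne k,k+1,\\ a_{k+1,i}\mapsto a_{ki},\quad a_{i,k+1}\mapsto a_{ik}, & i\ne k,k+1,\\ a_{k,k+1}\mapsto a_{k+1,k},\quad a_{k+1,k}\mapsto a_{k,k+1},\\ a_{ij}\mapsto a_{ij}, & i,j\ne k,k+1. \end{cases} \] For $B\in B_n$ let $\phi_B^{\rm ext}$ be the automorphism of $\mathcal A_{n+1}$ assigned to $B$ viewed in $B_{n+1}$ by adding a trivial strand labeled $n+1$, and let $\Phi^L_B,\Phi^R_B\in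 \operatorname{Mat}_n(\mathcal A_n)$ be the matrices determined by \[ \phi_B^{\rm ext}(a_{i,n+1})=\sum_{\ell=1}^n(\Phi^L_B)_{i\ell}\,a_{\ell,n+1},\qquad \phi_B^{\rm ext}(a_{n+1,i})=\sum_{\ell=1}^n a_{n+1,\ell}\,(\Phi^R_B)_{\ell i}\qquad(1\le i\le n). \] Let $\hat{\mathbf A},\check{\mathbf A}\in\operatorname{Mat}_n(\mathcal A_n)$ have entries \[ \hat{\mathbf A}_{ij}=\begin{cases}a_{ij}&i>j\\-1-\mu U&i=j\\\mu U a_{ij}&i<j\end{cases}\qquad \check{\mathbf A}_{ij}=\begin{cases}Va_{ij}&i>j\\-V-\mu&i=j\\\mu a_{ij}&i<j,\end{cases} \] and let $\Lambda_B=\operatorname{diag}(\lambda\mu^{-w(B)},1,\dots,1)$, where $w(B)$ is the writhe (the exponent sum of $B$ in the $\sigma_k$). The degree-$0$ transverse homology of $B$ is the $R[U,V]$-algebra \[ HT^-_0(B)=\mathcal A_n\,\big/\,\bigl(\hat{\mathbf A}-\Lambda_B\Phi^L_B\check{\mathbf A},\ \check{\mathbf A}-\hat{\mathbf A}\,\Phi^R_B\Lambda_B^{-1}\bigr),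 \] the quotient by the two-sided ideal generated by the entries of the two matrices. **Proposition 3.4.** Let $B\in B_n$ and $\tilde B\in B_m$ be braids, and suppose that the closure of $B$ is a (one-component) knot. If $B$ and $\tilde B$ are related by a finite sequence of conjugations in braid groups, positive stabilizations ($C\in B_k$ is replaced by $C\sigma_k\in B_{k+1}$) and positive destabilizations (the inverse operation), then there is an isomorphism of $R[U,V]$-algebras \[ HT^-_0(B)\cong HT^-_0(\tilde B). \] That is, $HT^-_0$ is an invariant of transverse knots. -/

import Mathlib

noncomputable section

namespace TransverseHomology

/-! ### Braid groups, with their Artin presentation -/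

/-- Relators of the braid group on the generators `σ_0, …, σ_{n-1}`:
`σ_i σ_j = σ_j σ_i` for `|i - j| ≥ 2`, and `σ_i σ_{i+1} σ_i = σ_{i+1} σ_i σ_{i+1}`. -/
def braidRels (n : ℕ) : Set (FreeGroup (Fin n)) :=
  {r | (∃ i j : Fin n, i.val + 1 < j.val ∧
          r = FreeGroup.of i * FreeGroup.of j * (FreeGroup.of j * FreeGroup.of i)⁻¹) ∨
       (∃ i j : Fin n, j.val = i.val + 1 ∧
          r = FreeGroup.of i * FreeGroup.of j * FreeGroup.of i *
            (FreeGroup.of j * FreeGroup.of i * FreeGroup.of j)⁻¹)}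

/-- `BraidGroup n` is the braid group on `n + 1` strands (it has `n` Artin generators).
The strands are indexed by `Fin (n + 1)`. -/
abbrev BraidGroup (n : ℕ) : Type := PresentedGroup (braidRels n)

/-- The Artin generator `σ_k`, which involves the strands `k` and `k + 1`
(that is, `k.castSucc` and `k.succ`). -/
def sigma {n : ℕ} (k : Fin n) : BraidGroup n := PresentedGroup.of k

/-- The universal property of the Artin presentation. -/
def braidLift {n : ℕ} {G : Type*} [Group G] (f : Fin n → G)
    (hcomm : ∀ i j : Fin n, i.val + 1 < j.val → f i * f j = f j * f i)
    (hbraid : ∀ i j : Fin n, j.val = i.val + 1 → f i * f j * f i = f j * f i * f j) :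
    BraidGroup n →* G :=
  PresentedGroup.toGroup (f := f) (by
    rintro r (⟨i, j, h, rfl⟩ | ⟨i, j, h, rfl⟩)
    · simp only [map_mul, map_inv, FreeGroup.lift_apply_of]
      rw [hcomm i j h]; group
    · simp only [map_mul, map_inv, FreeGroup.lift_apply_of]
      rw [hbraid i j h]; group)

theorem braidLift_sigma {n : ℕ} {G : Type*} [Group G] (f : Fin n → G) (hcomm) (hbraid)
    (k : Fin n) : braidLift f hcomm hbraid (sigma k) = f k :=
  PresentedGroup.toGroup.of _

theorem sigma_comm {n : ℕ} (i j : Fin n) (h : i.val + 1 < j.val) :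
    sigma i * sigma j = sigma j * sigma i := by
  have h1 : PresentedGroup.mk (braidRels n)
      (FreeGroup.of i * FreeGroup.of j * (FreeGroup.of j * FreeGroup.of i)⁻¹) = 1 :=
    PresentedGroup.one_of_mem (Or.inl ⟨i, j, h, rfl⟩)
  rw [map_mul, map_inv, mul_inv_eq_one, map_mul, map_mul] at h1
  exact h1

theorem sigma_braid {n : ℕ} (i j : Fin n) (h : j.val = i.val + 1) :
    sigma i * sigma j * sigma i = sigma j * sigma i * sigma j := by
  have h1 : PresentedGroup.mk (braidRels n)
      (FreeGroup.of i * FreeGroup.of j * FreeGroup.of i *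
            (FreeGroup.of j * FreeGroup.of i * FreeGroup.of j)⁻¹) = 1 :=
    PresentedGroup.one_of_mem (Or.inr ⟨i, j, h, rfl⟩)
  rw [map_mul, map_inv, mul_inv_eq_one, map_mul, map_mul, map_mul, map_mul] at h1
  exact h1

/-- Induction over braid words: left multiplication by `σ_k` and by `σ_k⁻¹`. -/
theorem braid_induction {n : ℕ} {p : BraidGroup n → Prop} (B : BraidGroup n) (h1 : p 1)
    (hs : ∀ k B, p B → p (sigma k * B)) (hi : ∀ k B, p B → p ((sigma k)⁻¹ * B)) : p B := by
  have hB : B ∈ Subgroup.closure (Set.range (PresentedGroup.of (rels := braidRels n))) := by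
    rw [PresentedGroup.closure_range_of]; trivial
  induction hB using Subgroup.closure_induction_left with
  | one => exact h1
  | mul_left x hx y _ ih =>
    obtain ⟨k, rfl⟩ := hx
    exact hs k y ih
  | inv_mul_cancel x hx y _ ih =>
    obtain ⟨k, rfl⟩ := hx
    exact hi k y ih

/-- The inclusion of braid groups that adds one trivial strand after the last one. -/
def addStrand {n : ℕ} : BraidGroup n →* BraidGroup (n + 1) :=
  braidLift (fun k => sigma k.castSucc)
    (fun i j h => sigma_comm _ _ (by simpa using h))
    (fun i j h => sigma_braid _ _ (by simpa using h))

/-- The writhe (algebraic crossing number) of a braid, as a homomorphism `σ_k ↦ 1`. -/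
def writheHom {n : ℕ} : BraidGroup n →* Multiplicative ℤ :=
  braidLift (fun _ => Multiplicative.ofAdd 1) (fun _ _ _ => rfl) (fun _ _ _ => rfl)

/-- The writhe (algebraic crossing number) of a braid. -/
def writhe {n : ℕ} (B : BraidGroup n) : ℤ := (writheHom B).toAdd

/-- The permutation of the strands that underlies a braid. -/
def braidPerm {n : ℕ} : BraidGroup n →* Equiv.Perm (Fin (n + 1)) :=
  braidLift (fun k => Equiv.swap k.castSucc k.succ)
    (fun i j h => by
      refine (Equiv.Perm.disjoint_swap_swap ?_).commute.eq
      simp [Fin.ext_iff]; omega)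
    (fun i j h => by
      have hs : j.castSucc = i.succ := by ext; simpa using h
      have hne : i.castSucc ≠ i.succ := by simp [Fin.ext_iff]
      have hne2 : i.castSucc ≠ j.succ := by simp [Fin.ext_iff]; omega
      have hne3 : i.succ ≠ j.succ := by simp [Fin.ext_iff]; omega
      rw [hs]
      ext x
      simp only [Equiv.Perm.mul_apply, Equiv.swap_apply_def]
      grind)

/-- The closure of a braid is a (one-component) knot: its permutation has a single cycle. -/
def ClosureIsKnot {n : ℕ} (B : BraidGroup n) : Prop :=
  ∀ i j : Fin (n + 1), (braidPerm B).SameCycle i j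

/-- A braid with any positive number of strands. -/
abbrev Braid : Type := Σ n : ℕ, BraidGroup n

/-- One braid conjugation or one positive braid stabilization `B ↦ B σ_n`. -/
inductive BraidMove : Braid → Braid → Prop
  | conj {n : ℕ} (B g : BraidGroup n) : BraidMove ⟨n, B⟩ ⟨n, g⁻¹ * B * g⟩
  | stab {n : ℕ} (B : BraidGroup n) :
      BraidMove ⟨n, B⟩ ⟨n + 1, addStrand B * sigma (Fin.last n)⟩

/-- Two braids represent the same transverse link: they are related by a finite sequence of
conjugations, positive stabilizations and positive destabilizations. -/
def TransverseEquiv : Braid → Braid → Prop := Relation.EqvGen BraidMove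

/-! ### Coefficients and the algebra on the `a_{ij}` -/

/-- `R = ℤ[λ^{±1}, μ^{±1}]`, as Laurent polynomials in `λ` over Laurent polynomials in `μ`. -/
abbrev R : Type := LaurentPolynomial (LaurentPolynomial ℤ)

/-- `R[U, V]`, with `U` and `V` the variables `0` and `1`. -/
def RUV : Type := MvPolynomial (Fin 2) R

instance : CommRing RUV := inferInstanceAs (CommRing (MvPolynomial (Fin 2) R))

/-- The variable `U`. -/
def varU : RUV := (MvPolynomial.X 0 : MvPolynomial (Fin 2) R)

/-- The variable `V`. -/
def varV : RUV := (MvPolynomial.X 1 : MvPolynomial (Fin 2) R)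

/-- The inclusion of `R` in `R[U, V]`. -/
def ofR : R →+* RUV := (MvPolynomial.C : R →+* MvPolynomial (Fin 2) R)

/-- The invertible variable `λ`, as a unit of `R[U, V]`. -/
def lam : RUVˣ where
  val := ofR (LaurentPolynomial.T 1)
  inv := ofR (LaurentPolynomial.T (-1))
  val_inv := by rw [← map_mul, ← LaurentPolynomial.T_add]; simp
  inv_val := by rw [← map_mul, ← LaurentPolynomial.T_add]; simp

/-- The invertible variable `μ`, as a unit of `R[U, V]`. -/
def mu : RUVˣ where
  val := ofR (LaurentPolynomial.C (LaurentPolynomial.T 1))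
  inv := ofR (LaurentPolynomial.C (LaurentPolynomial.T (-1)))
  val_inv := by rw [← map_mul, ← map_mul, ← LaurentPolynomial.T_add]; simp
  inv_val := by rw [← map_mul, ← map_mul, ← LaurentPolynomial.T_add]; simp

/-- The tensor algebra over `R[U, V]` on the `a_{ij}` with `i ≠ j` in `ι`. -/
abbrev Alg (ι : Type) : Type := FreeAlgebra RUV {p : ι × ι // p.1 ≠ p.2}

section twist

variable {ι : Type} [DecidableEq ι]

/-- The generator `a_{ij}` for `i ≠ j` (the value at `i = j` is never used). -/
def a (i j : ι) : Alg ι := if h : i ≠ j then FreeAlgebra.ι RUV ⟨(i, j), h⟩ else 0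

theorem alg_hom_ext {C : Type*} [Semiring C] [Algebra RUV C] {f g : Alg ι →ₐ[RUV] C}
    (h : ∀ i j, i ≠ j → f (a i j) = g (a i j)) : f = g := by
  apply FreeAlgebra.hom_ext
  funext ⟨⟨i, j⟩, hij⟩
  have := h i j hij
  simpa [a, show i ≠ j from hij] using this

/-- The value of `φ_{σ}` on `a_{ij}`, where `σ` exchanges the adjacent strands `k`, `l = k + 1`. -/
def twistVal (k l i j : ι) : Alg ι :=
  if i = k then (if j = l then a l k else -a l j - a l k * a k j)
  else if i = l then (if j = k then a k l else a k j)
  else if j = k then -a i l - a i k * a k l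
  else if j = l then a i k
  else a i j

/-- The value of `φ_{σ⁻¹}` on `a_{ij}`. -/
def twistInvVal (k l i j : ι) : Alg ι :=
  if i = l then (if j = k then a k l else -a k j - a k l * a l j)
  else if i = k then (if j = l then a l k else a l j)
  else if j = l then -a i k - a i l * a l k
  else if j = k then a i l
  else a i j

/-- `φ_{σ}` as an endomorphism. -/
def twistHom (k l : ι) : Alg ι →ₐ[RUV] Alg ι :=
  FreeAlgebra.lift RUV fun p => twistVal k l p.1.1 p.1.2

/-- `φ_{σ⁻¹}` as an endomorphism. -/
def twistInvHom (k l : ι) : Alg ι →ₐ[RUV] Alg ι :=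
  FreeAlgebra.lift RUV fun p => twistInvVal k l p.1.1 p.1.2

theorem twistHom_a (k l i j : ι) (h : i ≠ j) : twistHom k l (a i j) = twistVal k l i j := by
  simp [twistHom, a, h]

theorem twistInvHom_a (k l i j : ι) (h : i ≠ j) :
    twistInvHom k l (a i j) = twistInvVal k l i j := by
  simp [twistInvHom, a, h]

theorem twist_comp_inv (k l : ι) (h : k ≠ l) :
    (twistHom k l).comp (twistInvHom k l) = AlgHom.id RUV (Alg ι) := by
  apply alg_hom_ext
  intro i j hij
  simp only [AlgHom.comp_apply, AlgHom.id_apply, twistInvHom_a _ _ _ _ hij]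
  unfold twistInvVal
  split_ifs <;> subst_vars <;>
    (simp (discharger := first | assumption | (symm; assumption) | simp_all) only
      [map_sub, map_neg, map_mul, twistHom_a]
     simp_all [twistVal, eq_comm])

theorem twist_inv_comp (k l : ι) (h : k ≠ l) :
    (twistInvHom k l).comp (twistHom k l) = AlgHom.id RUV (Alg ι) := by
  apply alg_hom_ext
  intro i j hij
  simp only [AlgHom.comp_apply, AlgHom.id_apply, twistHom_a _ _ _ _ hij]
  unfold twistVal
  split_ifs <;> subst_vars <;>
    (simp (discharger := first | assumption | (symm; assumption) | simp_all) only
      [map_sub, map_neg, map_mul, twistInvHom_a]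
     simp_all [twistInvVal, eq_comm])

/-- `φ_{σ}` as an automorphism, where `σ` exchanges the adjacent strands `k`, `l = k + 1`. -/
def twist (k l : ι) (h : k ≠ l) : Alg ι ≃ₐ[RUV] Alg ι :=
  AlgEquiv.ofAlgHom (twistHom k l) (twistInvHom k l) (twist_comp_inv k l h) (twist_inv_comp k l h)

theorem twist_a (k l : ι) (h : k ≠ l) (i j : ι) (hij : i ≠ j) :
    twist k l h (a i j) = twistVal k l i j := twistHom_a k l i j hij

theorem twist_symm_a (k l : ι) (h : k ≠ l) (i j : ι) (hij : i ≠ j) :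
    (twist k l h).symm (a i j) = twistInvVal k l i j := twistInvHom_a k l i j hij

theorem alg_equiv_ext {f g : Alg ι ≃ₐ[RUV] Alg ι}
    (h : ∀ i j, i ≠ j → f (a i j) = g (a i j)) : f = g := by
  have : (f : Alg ι →ₐ[RUV] Alg ι) = g := alg_hom_ext h
  ext x
  exact DFunLike.congr_fun this x

theorem twist_comm (k l k' l' : ι) (h : k ≠ l) (h' : k' ≠ l') (h1 : k ≠ k') (h2 : k ≠ l')
    (h3 : l ≠ k') (h4 : l ≠ l') :
    twist k l h * twist k' l' h' = twist k' l' h' * twist k l h := by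
  apply alg_equiv_ext
  intro i j hij
  have h1' := h1.symm
  have h2' := h2.symm
  have h3' := h3.symm
  have h4' := h4.symm
  simp only [AlgEquiv.mul_apply, twist_a _ _ _ _ _ hij]
  unfold twistVal
  split_ifs <;> subst_vars <;>
    (simp (discharger := first | assumption | (symm; assumption) | simp_all) only
      [map_sub, map_neg, map_mul, twist_a]
     try simp_all [twistVal, eq_comm]
     try noncomm_ring)

theorem twist_braid (k l m : ι) (h : k ≠ l) (h' : l ≠ m) (h1 : k ≠ m) :
    twist k l h * twist l m h' * twist k l h = twist l m h' * twist k l h * twist l m h' := by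
  apply alg_equiv_ext
  intro i j hij
  have hs := h.symm
  have hs' := h'.symm
  have h1' := h1.symm
  have hij' := hij.symm
  have key : ∀ i : ι, i = k ∨ i = l ∨ i = m ∨
      ((i ≠ k ∧ k ≠ i) ∧ (i ≠ l ∧ l ≠ i) ∧ (i ≠ m ∧ m ≠ i)) := by
    intro i
    by_cases e1 : i = k <;> by_cases e2 : i = l <;> by_cases e3 : i = m <;>
      simp_all [eq_comm]
  simp only [AlgEquiv.mul_apply]
  rcases key i with rfl | rfl | rfl | ⟨⟨hi1, hi1'⟩, ⟨hi2, hi2'⟩, ⟨hi3, hi3'⟩⟩ <;>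
  rcases key j with rfl | rfl | rfl | ⟨⟨hj1, hj1'⟩, ⟨hj2, hj2'⟩, ⟨hj3, hj3'⟩⟩ <;>
  first
  | exact absurd rfl hij
  | (simp (discharger := assumption) only [twist_a, twistVal, if_true, if_neg,
      map_sub, map_neg, map_mul]
     try noncomm_ring)

end twist

/-! ### The braid group action and the matrices `Φ^L`, `Φ^R` -/

/-- The algebra `𝒜` of an `(n + 1)`-strand braid. -/
abbrev A (n : ℕ) : Type := Alg (Fin (n + 1))

/-- The action `φ` of the braid group on `𝒜` by automorphisms. -/
def phi {n : ℕ} : BraidGroup n →* (A n ≃ₐ[RUV] A n) :=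
  braidLift (fun k => twist k.castSucc k.succ k.castSucc_lt_succ.ne)
    (fun i j h => by
      apply twist_comm <;> simp [Fin.ext_iff] <;> omega)
    (fun i j h => by
      have hs : j.castSucc = i.succ := by ext; simpa using h
      have h1 : i.castSucc ≠ j.succ := by simp [Fin.ext_iff]; omega
      have h2 : i.succ ≠ j.succ := by simp [Fin.ext_iff]; omega
      simp only [hs]
      exact twist_braid _ _ _ _ h2 h1)

theorem phi_sigma {n : ℕ} (k : Fin n) :
    phi (sigma k) = twist k.castSucc k.succ k.castSucc_lt_succ.ne := braidLift_sigma _ _ _ _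

/-- The inclusion of algebras `a_{ij} ↦ a_{ij}` that adds one strand after the last one. -/
def incl {n : ℕ} : A n →ₐ[RUV] A (n + 1) :=
  FreeAlgebra.lift RUV fun p => a p.1.1.castSucc p.1.2.castSucc

theorem incl_a {n : ℕ} (i j : Fin (n + 1)) (h : i ≠ j) :
    incl (a i j) = a i.castSucc j.castSucc := by
  simp [incl, a, h]

/-- `φ^{ext}_B`: the automorphism of the braid `B` with an additional last strand. -/
def phiExt {n : ℕ} (B : BraidGroup n) : A (n + 1) ≃ₐ[RUV] A (n + 1) := phi (addStrand B)

theorem phiExt_one {n : ℕ} : phiExt (1 : BraidGroup n) = 1 := by simp [phiExt]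

theorem phiExt_mul {n : ℕ} (B C : BraidGroup n) : phiExt (B * C) = phiExt B * phiExt C := by
  simp [phiExt]

theorem phiExt_inv {n : ℕ} (B : BraidGroup n) : phiExt B⁻¹ = (phiExt B)⁻¹ := by
  simp [phiExt]

theorem phiExt_sigma {n : ℕ} (k : Fin n) : phiExt (sigma k) =
    twist k.castSucc.castSucc k.succ.castSucc
      (by simp [Fin.ext_iff]) := by
  simp only [phiExt, addStrand, braidLift_sigma, phi_sigma]
  rfl

theorem incl_twistVal {n : ℕ} (k l i j : Fin (n + 1)) (h : k ≠ l) (hij : i ≠ j) :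
    incl (twistVal k l i j) = twistVal k.castSucc l.castSucc i.castSucc j.castSucc := by
  simp only [twistVal, Fin.castSucc_inj]
  split_ifs <;> subst_vars <;>
    (simp (discharger := first | assumption | (symm; assumption) | simp_all) only
      [map_sub, map_neg, map_mul, incl_a])

theorem phiExt_incl {n : ℕ} (B : BraidGroup n) (x : A n) :
    phiExt B (incl x) = incl (phi B x) := by
  have hs : ∀ (k : Fin n) (x : A n), phiExt (sigma k) (incl x) = incl (phi (sigma k) x) := by
    intro k x
    have : ((phiExt (sigma k)).toAlgHom.comp incl) =
        (incl.comp (phi (sigma k)).toAlgHom) := by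
      apply alg_hom_ext
      intro i j hij
      have hij' : i.castSucc ≠ j.castSucc := by simpa using hij
      simp only [AlgHom.comp_apply, AlgEquiv.toAlgHom_apply, phiExt_sigma, phi_sigma,
        incl_a _ _ hij, twist_a _ _ _ _ _ hij, twist_a _ _ _ _ _ hij']
      exact (incl_twistVal _ _ _ _ k.castSucc_lt_succ.ne hij).symm
    exact DFunLike.congr_fun this x
  induction B using braid_induction generalizing x with
  | h1 => simp [phiExt_one]
  | hs k B ih => rw [phiExt_mul, map_mul, AlgEquiv.mul_apply, ih, hs, AlgEquiv.mul_apply]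
  | hi k B ih =>
    rw [phiExt_mul, map_mul, AlgEquiv.mul_apply, ih, AlgEquiv.mul_apply]
    apply (phiExt (sigma k)).injective
    rw [hs, phiExt_inv, map_inv, ← AlgEquiv.mul_apply, ← AlgEquiv.mul_apply, mul_inv_cancel,
      mul_inv_cancel]
    simp

/-- The defining property of `Φ^L_B`: `φ^{ext}_B(a_{i,*}) = ∑_l (Φ^L_B)_{il} a_{l,*}`,
where `*` is the additional last strand. -/
def IsPhiL {n : ℕ} (B : BraidGroup n) (M : Matrix (Fin (n + 1)) (Fin (n + 1)) (A n)) : Prop :=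
  ∀ i, phiExt B (a i.castSucc (Fin.last (n + 1))) =
    ∑ l, incl (M i l) * a l.castSucc (Fin.last (n + 1))

/-- The defining property of `Φ^R_B`: `φ^{ext}_B(a_{*,i}) = ∑_l a_{*,l} (Φ^R_B)_{li}`,
where `*` is the additional last strand. -/
def IsPhiR {n : ℕ} (B : BraidGroup n) (M : Matrix (Fin (n + 1)) (Fin (n + 1)) (A n)) : Prop :=
  ∀ i, phiExt B (a (Fin.last (n + 1)) i.castSucc) =
    ∑ l, a (Fin.last (n + 1)) l.castSucc * incl (M l i)

theorem exists_rowL {n : ℕ} (B : BraidGroup n) (i : Fin (n + 1)) :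
    ∃ x : Fin (n + 1) → A n, phiExt B (a i.castSucc (Fin.last (n + 1))) =
      ∑ l, incl (x l) * a l.castSucc (Fin.last (n + 1)) := by
  let P : A (n + 1) → Prop := fun y => ∃ x : Fin (n + 1) → A n,
    y = ∑ l, incl (x l) * a l.castSucc (Fin.last (n + 1))
  have hadd : ∀ y z, P y → P z → P (y + z) := by
    rintro _ _ ⟨x, rfl⟩ ⟨x', rfl⟩
    exact ⟨x + x', by simp [add_mul, Finset.sum_add_distrib]⟩
  have hmul : ∀ c y, P y → P (incl c * y) := by
    rintro c _ ⟨x, rfl⟩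
    exact ⟨fun l => c * x l, by simp [Finset.mul_sum, mul_assoc]⟩
  have hneg : ∀ y, P y → P (-y) := by
    intro y hy
    simpa using hmul (-1) y hy
  have hgen : ∀ j : Fin (n + 1), P (a j.castSucc (Fin.last (n + 1))) := fun j =>
    ⟨Pi.single j 1, by simp [Pi.single_apply, apply_ite incl, Finset.sum_ite_eq']⟩
  have hzero : P 0 := ⟨0, by simp⟩
  have hsum : ∀ f : Fin (n + 1) → A (n + 1), (∀ l, P (f l)) → P (∑ l, f l) := fun f hf =>
    Finset.sum_induction f P hadd hzero fun l _ => hf l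
  have hne : ∀ j : Fin (n + 1), j.castSucc ≠ Fin.last (n + 1) := fun j => j.castSucc_lt_last.ne
  have hstep : ∀ C : BraidGroup n, (∀ j : Fin (n + 1),
      P (phiExt C (a j.castSucc (Fin.last (n + 1))))) → ∀ y, P y → P (phiExt C y) := by
    rintro C hC _ ⟨x, rfl⟩
    rw [map_sum]
    refine hsum _ fun l => ?_
    rw [map_mul, phiExt_incl]
    exact hmul _ _ (hC l)
  have hval : ∀ (k l : Fin (n + 1)), k ≠ l → ∀ j : Fin (n + 1),
      P (twistVal k.castSucc l.castSucc j.castSucc (Fin.last (n + 1))) ∧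
      P (twistInvVal k.castSucc l.castSucc j.castSucc (Fin.last (n + 1))) := by
    intro k l hkl j
    simp only [twistVal, twistInvVal, (hne _).symm, if_false, sub_eq_add_neg, ← neg_mul,
      ← incl_a _ _ hkl, ← incl_a _ _ hkl.symm, ← map_neg]
    constructor <;> split_ifs <;>
      first
      | exact hgen _
      | exact hadd _ _ (hneg _ (hgen _)) (hmul _ _ (hgen _))
  have main : ∀ y, P y → P (phiExt B y) := by
    induction B using braid_induction with
    | h1 => intro y hy; simpa [phiExt_one] using hy
    | hs k B ih =>
      intro y hy
      rw [phiExt_mul, AlgEquiv.mul_apply]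
      refine hstep _ (fun j => ?_) _ (ih y hy)
      rw [phiExt_sigma, twist_a _ _ _ _ _ (hne j)]
      exact (hval _ _ k.castSucc_lt_succ.ne j).1
    | hi k B ih =>
      intro y hy
      rw [phiExt_mul, AlgEquiv.mul_apply]
      refine hstep _ (fun j => ?_) _ (ih y hy)
      rw [phiExt_inv, phiExt_sigma]
      have := (hval _ _ k.castSucc_lt_succ.ne j).2
      rwa [← twist_symm_a _ _ (by simp [Fin.ext_iff]) _ _ (hne j)] at this
  exact main _ (hgen i)

theorem exists_colR {n : ℕ} (B : BraidGroup n) (i : Fin (n + 1)) :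
    ∃ x : Fin (n + 1) → A n, phiExt B (a (Fin.last (n + 1)) i.castSucc) =
      ∑ l, a (Fin.last (n + 1)) l.castSucc * incl (x l) := by
  let P : A (n + 1) → Prop := fun y => ∃ x : Fin (n + 1) → A n,
    y = ∑ l, a (Fin.last (n + 1)) l.castSucc * incl (x l)
  have hadd : ∀ y z, P y → P z → P (y + z) := by
    rintro _ _ ⟨x, rfl⟩ ⟨x', rfl⟩
    exact ⟨x + x', by simp [mul_add, Finset.sum_add_distrib]⟩
  have hmul : ∀ c y, P y → P (y * incl c) := by
    rintro c _ ⟨x, rfl⟩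
    exact ⟨fun l => x l * c, by simp [Finset.sum_mul, mul_assoc]⟩
  have hneg : ∀ y, P y → P (-y) := by
    intro y hy
    simpa using hmul (-1) y hy
  have hgen : ∀ j : Fin (n + 1), P (a (Fin.last (n + 1)) j.castSucc) := fun j =>
    ⟨Pi.single j 1, by simp [Pi.single_apply, apply_ite incl, Finset.sum_ite_eq']⟩
  have hzero : P 0 := ⟨0, by simp⟩
  have hsum : ∀ f : Fin (n + 1) → A (n + 1), (∀ l, P (f l)) → P (∑ l, f l) := fun f hf =>
    Finset.sum_induction f P hadd hzero fun l _ => hf l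
  have hne : ∀ j : Fin (n + 1), j.castSucc ≠ Fin.last (n + 1) := fun j => j.castSucc_lt_last.ne
  have hstep : ∀ C : BraidGroup n, (∀ j : Fin (n + 1),
      P (phiExt C (a (Fin.last (n + 1)) j.castSucc))) → ∀ y, P y → P (phiExt C y) := by
    rintro C hC _ ⟨x, rfl⟩
    rw [map_sum]
    refine hsum _ fun l => ?_
    rw [map_mul, phiExt_incl]
    exact hmul _ _ (hC l)
  have hval : ∀ (k l : Fin (n + 1)), k ≠ l → ∀ j : Fin (n + 1),
      P (twistVal k.castSucc l.castSucc (Fin.last (n + 1)) j.castSucc) ∧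
      P (twistInvVal k.castSucc l.castSucc (Fin.last (n + 1)) j.castSucc) := by
    intro k l hkl j
    simp only [twistVal, twistInvVal, (hne _).symm, if_false, sub_eq_add_neg, ← mul_neg,
      ← incl_a _ _ hkl, ← incl_a _ _ hkl.symm, ← map_neg]
    constructor <;> split_ifs <;>
      first
      | exact hgen _
      | exact hadd _ _ (hneg _ (hgen _)) (hmul _ _ (hgen _))
  have main : ∀ y, P y → P (phiExt B y) := by
    induction B using braid_induction with
    | h1 => intro y hy; simpa [phiExt_one] using hy
    | hs k B ih =>
      intro y hy
      rw [phiExt_mul, AlgEquiv.mul_apply]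
      refine hstep _ (fun j => ?_) _ (ih y hy)
      rw [phiExt_sigma, twist_a _ _ _ _ _ (hne j).symm]
      exact (hval _ _ k.castSucc_lt_succ.ne j).1
    | hi k B ih =>
      intro y hy
      rw [phiExt_mul, AlgEquiv.mul_apply]
      refine hstep _ (fun j => ?_) _ (ih y hy)
      rw [phiExt_inv, phiExt_sigma]
      have := (hval _ _ k.castSucc_lt_succ.ne j).2
      rwa [← twist_symm_a _ _ (by simp [Fin.ext_iff]) _ _ (hne j).symm] at this
  exact main _ (hgen i)

/-- A homomorphism that reads off the coefficient `c` in `c * a_{l,*}`. -/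
def coeffL {n : ℕ} (l : Fin (n + 1)) : A (n + 1) →ₐ[RUV] Matrix (Fin 2) (Fin 2) (A n) :=
  FreeAlgebra.lift RUV fun p =>
    Fin.lastCases (motive := fun _ => Matrix (Fin 2) (Fin 2) (A n))
      (Fin.lastCases (motive := fun _ => Matrix (Fin 2) (Fin 2) (A n)) 0
        (fun i => if i = l then !![0, 1; 0, 0] else 0) p.1.1)
      (fun j => Fin.lastCases (motive := fun _ => Matrix (Fin 2) (Fin 2) (A n)) 0
        (fun i => !![a i j, 0; 0, 0]) p.1.1) p.1.2

/-- A homomorphism that reads off the coefficient `c` in `a_{*,l} * c`. -/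
def coeffR {n : ℕ} (l : Fin (n + 1)) : A (n + 1) →ₐ[RUV] Matrix (Fin 2) (Fin 2) (A n) :=
  FreeAlgebra.lift RUV fun p =>
    Fin.lastCases (motive := fun _ => Matrix (Fin 2) (Fin 2) (A n))
      (Fin.lastCases (motive := fun _ => Matrix (Fin 2) (Fin 2) (A n)) 0
        (fun j => if j = l then !![0, 1; 0, 0] else 0) p.1.2)
      (fun i => Fin.lastCases (motive := fun _ => Matrix (Fin 2) (Fin 2) (A n)) 0
        (fun j => !![0, 0; 0, a i j]) p.1.2) p.1.1

theorem coeffL_incl {n : ℕ} (l : Fin (n + 1)) (x : A n) :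
    coeffL l (incl x) 0 0 = x ∧ coeffL l (incl x) 0 1 = 0 ∧ coeffL l (incl x) 1 0 = 0 := by
  induction x using FreeAlgebra.induction with
  | grade0 r => simp [AlgHom.commutes, Matrix.algebraMap_matrix_apply]
  | grade1 p => simp [coeffL, incl, a, p.2]
  | mul x y hx hy => simp [Matrix.mul_apply, hx, hy]
  | add x y hx hy => simp [hx, hy]

theorem coeffR_incl {n : ℕ} (l : Fin (n + 1)) (x : A n) :
    coeffR l (incl x) 1 1 = x ∧ coeffR l (incl x) 0 1 = 0 ∧ coeffR l (incl x) 1 0 = 0 := by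
  induction x using FreeAlgebra.induction with
  | grade0 r => simp [AlgHom.commutes, Matrix.algebraMap_matrix_apply]
  | grade1 p => simp [coeffR, incl, a, p.2]
  | mul x y hx hy => simp [Matrix.mul_apply, hx, hy]
  | add x y hx hy => simp [hx, hy]

theorem coeffL_sum {n : ℕ} (l : Fin (n + 1)) (x : Fin (n + 1) → A n) :
    coeffL l (∑ m, incl (x m) * a m.castSucc (Fin.last (n + 1))) 0 1 = x l := by
  have h : ∀ m : Fin (n + 1), coeffL l (a m.castSucc (Fin.last (n + 1))) =
      if m = l then !![0, 1; 0, 0] else 0 := by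
    intro m
    simp [coeffL, a, m.castSucc_lt_last.ne]
  rw [map_sum, Matrix.sum_apply, Finset.sum_eq_single l]
  · simp [h, Matrix.mul_apply, coeffL_incl]
  · intro m _ hm
    simp [h, hm]
  · simp

theorem coeffR_sum {n : ℕ} (l : Fin (n + 1)) (x : Fin (n + 1) → A n) :
    coeffR l (∑ m, a (Fin.last (n + 1)) m.castSucc * incl (x m)) 0 1 = x l := by
  have h : ∀ m : Fin (n + 1), coeffR l (a (Fin.last (n + 1)) m.castSucc) =
      if m = l then !![0, 1; 0, 0] else 0 := by
    intro m
    simp [coeffR, a, m.castSucc_lt_last.ne']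
  rw [map_sum, Matrix.sum_apply, Finset.sum_eq_single l]
  · simp [h, Matrix.mul_apply, coeffR_incl]
  · intro m _ hm
    simp [h, hm]
  · simp

theorem existsUnique_phiL {n : ℕ} (B : BraidGroup n) : ∃! M, IsPhiL B M := by
  choose M hM using exists_rowL B
  refine ⟨Matrix.of M, hM, fun N hN => ?_⟩
  ext i l : 2
  rw [← coeffL_sum l (N i), ← hN i, hM i, coeffL_sum, Matrix.of_apply]

theorem existsUnique_phiR {n : ℕ} (B : BraidGroup n) : ∃! M, IsPhiR B M := by
  choose M hM using exists_colR B
  refine ⟨Matrix.of fun l i => M i l, hM, fun N hN => ?_⟩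
  ext l i : 2
  rw [← coeffR_sum l (fun l => N l i), ← hN i, hM i, coeffR_sum, Matrix.of_apply]

/-- The matrix `Φ^L_B`. -/
def PhiL {n : ℕ} (B : BraidGroup n) : Matrix (Fin (n + 1)) (Fin (n + 1)) (A n) :=
  (existsUnique_phiL B).choose

theorem PhiL_spec {n : ℕ} (B : BraidGroup n) : IsPhiL B (PhiL B) :=
  (existsUnique_phiL B).choose_spec.1

/-- The matrix `Φ^R_B`. -/
def PhiR {n : ℕ} (B : BraidGroup n) : Matrix (Fin (n + 1)) (Fin (n + 1)) (A n) :=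
  (existsUnique_phiR B).choose

theorem PhiR_spec {n : ℕ} (B : BraidGroup n) : IsPhiR B (PhiR B) :=
  (existsUnique_phiR B).choose_spec.1

/-! ### Degree-zero transverse homology -/

/-- The lower triangular matrix `A_≥`. -/
def Alow (n : ℕ) : Matrix (Fin (n + 1)) (Fin (n + 1)) (A n) :=
  Matrix.of fun i j => if j < i then a i j else if i = j then -1 else 0

/-- The upper triangular matrix `A_≤`. -/
def Aupp (n : ℕ) : Matrix (Fin (n + 1)) (Fin (n + 1)) (A n) :=
  Matrix.of fun i j => if i < j then a i j else if i = j then -1 else 0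

/-- `Â = A_≥ + μ U A_≤`. -/
def Ahat (n : ℕ) : Matrix (Fin (n + 1)) (Fin (n + 1)) (A n) :=
  Alow n + ((mu : RUV) * varU) • Aupp n

/-- `Ǎ = V A_≥ + μ A_≤`. -/
def Acheck (n : ℕ) : Matrix (Fin (n + 1)) (Fin (n + 1)) (A n) :=
  varV • Alow n + (mu : RUV) • Aupp n

/-- The diagonal entries `(λ μ^{-w(B)}, 1, …, 1)` of `Λ_B`. -/
def lamEntry {n : ℕ} (B : BraidGroup n) (i : Fin (n + 1)) : RUVˣ :=
  if i = 0 then lam * mu ^ (-writhe B) else 1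

/-- `Λ_B = diag(λ μ^{-w(B)}, 1, …, 1)`. -/
def Lam {n : ℕ} (B : BraidGroup n) : Matrix (Fin (n + 1)) (Fin (n + 1)) (A n) :=
  Matrix.diagonal fun i => algebraMap RUV (A n) (lamEntry B i)

/-- `Λ_B⁻¹`. -/
def LamInv {n : ℕ} (B : BraidGroup n) : Matrix (Fin (n + 1)) (Fin (n + 1)) (A n) :=
  Matrix.diagonal fun i => algebraMap RUV (A n) ((lamEntry B i)⁻¹ : RUVˣ)

theorem Lam_mul_LamInv {n : ℕ} (B : BraidGroup n) : Lam B * LamInv B = 1 := by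
  simp [Lam, LamInv, ← map_mul]

theorem LamInv_mul_Lam {n : ℕ} (B : BraidGroup n) : LamInv B * Lam B = 1 := by
  simp [Lam, LamInv, ← map_mul]

/-- The relations that set all entries of `Â - Λ_B Φ^L_B Ǎ` and of `Ǎ - Â Φ^R_B Λ_B⁻¹` to `0`. -/
inductive HTRel {n : ℕ} (B : BraidGroup n) : A n → A n → Prop
  | left (i j : Fin (n + 1)) : HTRel B ((Ahat n - Lam B * PhiL B * Acheck n) i j) 0
  | right (i j : Fin (n + 1)) : HTRel B ((Acheck n - Ahat n * PhiR B * LamInv B) i j) 0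

/-- The degree-`0` transverse homology `HT⁻_0(B)`: the quotient of `𝒜` by the two-sided ideal
generated by the entries of `Â - Λ_B Φ^L_B Ǎ` and `Ǎ - Â Φ^R_B Λ_B⁻¹`. -/
abbrev HTminusZero {n : ℕ} (B : BraidGroup n) : Type := RingQuot (HTRel B)

end TransverseHomology

end

/-! The idea is to replace `Λ_B` by an arbitrary diagonal matrix `D` of units and to study maps `f`
out of `𝒜` under which `Â = D Φ^L_B Ǎ` and `Ǎ D = Â Φ^R_B` (`Solves`). The quotient `TwistedHT B D`
carries the universal such map, so an isomorphism of quotients amounts to mutually inverse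
substitutions of the `a_{ij}` that carry solutions to solutions (`nonempty_algEquiv`).

Two identities drive everything. The first is `φ_B(M) = Φ^L_B M Φ^R_B` for `M = Â` and `M = Ǎ`
(`map_phi_genA`), which follows from the chain rule for `Φ` and a check on generators. The second is
that the rescaling `a_{ij} ↦ T_i⁻¹ T_j a_{ij}` multiplies `Φ^L_B` and `Φ^R_B` by diagonal matrices
that differ by the permutation of `B` (`map_rescale_Phi`). Together they show that in a solution
`φ_B` acts as the rescaling by `D` (`Solves.phi_eq`).

Three invariances follow. Rescaling moves a single nontrivial entry of `D` along the cycles of the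
permutation, hence to any strand when the closure is a knot. The substitution `φ_C` carries
solutions for `B` to solutions for `C⁻¹ B C`, with the entries of `D` permuted. For a positive
stabilization with the nontrivial entry `d` at the strand before the new one, the relations express
the new generators through the old ones, and what remains are the relations of `B` with entry `d μ`
(`solves_stab_iff`). The writhe grows by one under stabilization, and the factor `μ^{-w}` in `Λ_B`
compensates exactly for this `μ`. -/

noncomputable section

namespace TransverseHomology

/-! ### Matrices for the Artin generators -/

section generators

variable {ι : Type} [DecidableEq ι]

/-- The matrix `Φ^L` of the generator exchanging the adjacent strands `k` and `l`. -/
def sigmaL (k l : ι) : Matrix ι ι (Alg ι) :=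
  Matrix.of fun i j => if i = k then (if j = k then -a l k else if j = l then -1 else 0)
    else if i = l then (if j = k then 1 else 0) else if j = i then 1 else 0

/-- The matrix `Φ^R` of the generator exchanging the adjacent strands `k` and `l`. -/
def sigmaR (k l : ι) : Matrix ι ι (Alg ι) :=
  Matrix.of fun j i => if i = k then (if j = k then -a k l else if j = l then -1 else 0)
    else if i = l then (if j = k then 1 else 0) else if j = i then 1 else 0

/-- A row of `sigmaL` has at most two nonzero entries. An arbitrary ring homomorphism `f` is allowed
because the formula is applied to `incl`, to the identity, and to a solution composed with the braid
action. -/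
theorem sum_sigmaL [Fintype ι] {S : Type*} [Ring S] (f : Alg ι →+* S) {k l : ι} (h : k ≠ l)
    (i : ι) (x : ι → S) : ∑ m, f (sigmaL k l i m) * x m =
      if i = k then -f (a l k) * x k - x l else if i = l then x k else x i := by
  have hL : ∀ m, f (sigmaL k l i m) * x m = if i = k then
      ((if m = k then -f (a l k) * x k else 0) + if m = l then -x l else 0) else if i = l then
      (if m = k then x k else 0) else if m = i then x i else 0 := by
    intro m
    simp only [sigmaL, Matrix.of_apply]
    split_ifs <;> simp_all
  simp only [hL]
  split_ifs <;> simp [Finset.sum_add_distrib, sub_eq_add_neg]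

theorem sum_sigmaR [Fintype ι] {S : Type*} [Ring S] (f : Alg ι →+* S) {k l : ι} (h : k ≠ l)
    (i : ι) (x : ι → S) : ∑ m, x m * f (sigmaR k l m i) =
      if i = k then -(x k * f (a k l)) - x l else if i = l then x k else x i := by
  have hL : ∀ m, x m * f (sigmaR k l m i) = if i = k then
      ((if m = k then -(x k * f (a k l)) else 0) + if m = l then -x l else 0) else if i = l then
      (if m = k then x k else 0) else if m = i then x i else 0 := by
    intro m
    simp only [sigmaR, Matrix.of_apply]
    split_ifs <;> simp_all
  simp only [hL]
  split_ifs <;> simp [Finset.sum_add_distrib, sub_eq_add_neg]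

end generators

theorem PhiL_unique {n : ℕ} {B : BraidGroup n} {M} (h : IsPhiL B M) : PhiL B = M :=
  (existsUnique_phiL B).unique (PhiL_spec B) h

theorem PhiR_unique {n : ℕ} {B : BraidGroup n} {M} (h : IsPhiR B M) : PhiR B = M :=
  (existsUnique_phiR B).unique (PhiR_spec B) h

theorem PhiL_sigma {n : ℕ} (k : Fin n) : PhiL (sigma k) = sigmaL k.castSucc k.succ := by
  apply PhiL_unique
  intro i
  have hk := k.castSucc_lt_succ.ne
  rw [phiExt_sigma, twist_a _ _ _ _ _ i.castSucc_lt_last.ne]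
  have := sum_sigmaL (incl : A n →ₐ[RUV] A (n + 1)).toRingHom hk i
    (fun m => a m.castSucc (Fin.last (n + 1)))
  refine Eq.trans ?_ this.symm
  simp only [twistVal, Fin.castSucc_inj, (Fin.castSucc_lt_last _).ne', if_false]
  split_ifs <;> simp [incl_a _ _ hk.symm]; abel

theorem PhiR_sigma {n : ℕ} (k : Fin n) : PhiR (sigma k) = sigmaR k.castSucc k.succ := by
  apply PhiR_unique
  intro i
  have hk := k.castSucc_lt_succ.ne
  rw [phiExt_sigma, twist_a _ _ _ _ _ i.castSucc_lt_last.ne']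
  have := sum_sigmaR (incl : A n →ₐ[RUV] A (n + 1)).toRingHom hk i
    (fun m => a (Fin.last (n + 1)) m.castSucc)
  refine Eq.trans ?_ this.symm
  simp only [twistVal, Fin.castSucc_inj, (Fin.castSucc_lt_last _).ne', if_false]
  split_ifs <;> simp [incl_a _ _ hk]; abel

/-! ### The chain rule -/

/-- Apply `φ^{ext}_B` to the expansion of `φ^{ext}_C(a_{i*})`: it acts by `φ_B` on the coefficients
and by `Φ^L_B` on the generators `a_{l*}`. The coefficients stand on the left, so the factors appear
in reverse order; for `Φ^R` they keep their order. -/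
theorem PhiL_mul {n : ℕ} (B C : BraidGroup n) :
    PhiL (B * C) = (PhiL C).map (phi B) * PhiL B := by
  apply PhiL_unique
  intro i
  rw [phiExt_mul, AlgEquiv.mul_apply, PhiL_spec C i, map_sum]
  simp only [map_mul, phiExt_incl, PhiL_spec B _, Matrix.mul_apply, map_sum, Finset.mul_sum,
    Finset.sum_mul, Matrix.map_apply, mul_assoc]
  exact Finset.sum_comm

theorem PhiR_mul {n : ℕ} (B C : BraidGroup n) :
    PhiR (B * C) = PhiR B * (PhiR C).map (phi B) := by
  apply PhiR_unique
  intro i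
  rw [phiExt_mul, AlgEquiv.mul_apply, PhiR_spec C i, map_sum]
  simp only [map_mul, phiExt_incl, PhiR_spec B _, Matrix.mul_apply, map_sum, Finset.mul_sum,
    Finset.sum_mul, Matrix.map_apply, mul_assoc]
  exact Finset.sum_comm

theorem PhiL_one {n : ℕ} : PhiL (1 : BraidGroup n) = 1 := by
  apply PhiL_unique
  intro i
  simp [phiExt_one, Matrix.one_apply, apply_ite incl]

theorem PhiR_one {n : ℕ} : PhiR (1 : BraidGroup n) = 1 := by
  apply PhiR_unique
  intro i
  simp [phiExt_one, Matrix.one_apply, apply_ite incl]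

theorem phi_inv_phi {n : ℕ} (B : BraidGroup n) (x : A n) : phi B⁻¹ (phi B x) = x := by
  rw [← AlgEquiv.mul_apply, ← map_mul]; simp

theorem phi_phi_inv {n : ℕ} (B : BraidGroup n) (x : A n) : phi B (phi B⁻¹ x) = x := by
  rw [← AlgEquiv.mul_apply, ← map_mul]; simp

theorem map_phi_PhiL_inv_mul {n : ℕ} (B : BraidGroup n) :
    (PhiL B⁻¹).map (phi B) * PhiL B = 1 := by
  rw [← PhiL_mul, mul_inv_cancel, PhiL_one]

/-- Over a noncommutative ring both one-sided inverses are wanted. This one is the chain rule for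
`B⁻¹ B`, transported by `φ_B`. -/
theorem PhiL_mul_map_phi_inv {n : ℕ} (B : BraidGroup n) :
    PhiL B * (PhiL B⁻¹).map (phi B) = 1 := by
  have h := congrArg (fun M => M.map (phi B)) (PhiL_mul B⁻¹ B)
  rw [inv_mul_cancel, PhiL_one] at h
  simpa [Matrix.map_mul, Matrix.map_map, Function.comp_def, phi_phi_inv] using h.symm

theorem map_phi_PhiR_inv_mul {n : ℕ} (B : BraidGroup n) :
    (PhiR B⁻¹).map (phi B) * PhiR B = 1 := by
  have h := congrArg (fun M => M.map (phi B)) (PhiR_mul B⁻¹ B)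
  rw [inv_mul_cancel, PhiR_one] at h
  simpa [Matrix.map_mul, Matrix.map_map, Function.comp_def, phi_phi_inv] using h.symm

theorem PhiR_mul_map_phi_inv {n : ℕ} (B : BraidGroup n) :
    PhiR B * (PhiR B⁻¹).map (phi B) = 1 := by
  rw [← PhiR_mul, mul_inv_cancel, PhiR_one]

/-- Induction over braids as a group. -/
theorem braid_group_induction {n : ℕ} {p : BraidGroup n → Prop} (B : BraidGroup n) (h1 : p 1)
    (hs : ∀ k, p (sigma k)) (hmul : ∀ B C, p B → p C → p (B * C)) (hinv : ∀ B, p B → p B⁻¹) :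
    p B :=
  braid_induction B h1 (fun k _ h => hmul _ _ (hs k) h) fun k _ h => hmul _ _ (hinv _ (hs k)) h

/-! ### The matrices with constant coefficients above and below the diagonal -/

/-- The matrix with entries `c a_{ij}` above and `d a_{ij}` below the diagonal, and `-(c + d)`
on the diagonal. -/
def genA (n : ℕ) (c d : RUV) : Matrix (Fin (n + 1)) (Fin (n + 1)) (A n) :=
  Matrix.of fun i j => if i < j then c • a i j else if j < i then d • a i j else
    -algebraMap RUV (A n) (c + d)

theorem genA_upper {n : ℕ} {c d : RUV} {i j : Fin (n + 1)} (h : i < j) :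
    genA n c d i j = c • a i j := by
  simp [genA, h]

theorem genA_lower {n : ℕ} {c d : RUV} {i j : Fin (n + 1)} (h : j < i) :
    genA n c d i j = d • a i j := by
  simp [genA, h, h.not_gt]

theorem genA_diag {n : ℕ} {c d : RUV} (i : Fin (n + 1)) :
    genA n c d i i = -algebraMap RUV (A n) (c + d) := by
  simp [genA]

/-- Both `Â` and `Ǎ` belong to the family `genA`, so one transformation law covers them. -/
theorem Ahat_eq (n : ℕ) : Ahat n = genA n ((mu : RUV) * varU) 1 := by
  ext i j
  simp only [Ahat, Alow, Aupp, genA, Matrix.add_apply, Matrix.smul_apply, Matrix.of_apply]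
  rcases lt_trichotomy i j with h | rfl | h
  · simp [h, h.ne, h.not_gt]
  · simp [Algebra.algebraMap_eq_smul_one, add_smul]
  · simp [h, h.ne', h.not_gt]

theorem Acheck_eq (n : ℕ) : Acheck n = genA n (mu : RUV) varV := by
  ext i j
  simp only [Acheck, Alow, Aupp, genA, Matrix.add_apply, Matrix.smul_apply, Matrix.of_apply]
  rcases lt_trichotomy i j with h | rfl | h
  · simp [h, h.ne, h.not_gt]
  · simp [Algebra.algebraMap_eq_smul_one, add_smul]
  · simp [h, h.ne', h.not_gt]

/-- The hypothesis `key` says that no index lies strictly between `K` and `L`, so every other index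
lies on the same side of both and keeps its coefficient `c` or `d`. At `(K, K)` the product contains
the quadratic terms `(c + d - (c + d)) a_{LK} a_{KL}`; they cancel because the diagonal is `-(c +
d)`. -/
theorem map_twist_genA {n : ℕ} (c d : RUV) (K L : Fin (n + 1)) (hkl : K < L)
    (key : ∀ i, i = K ∨ i = L ∨ (i < K ∧ i < L) ∨ (K < i ∧ L < i)) :
    (genA n c d).map (twist K L hkl.ne) = sigmaL K L * genA n c d * sigmaR K L := by
  ext i j
  have hL : ∀ (M : Matrix (Fin (n + 1)) (Fin (n + 1)) (A n)) i j, (sigmaL K L * M) i j = _ :=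
    fun M i j => sum_sigmaL (RingHom.id (A n)) hkl.ne i (fun m => M m j)
  have hR : ∀ (M : Matrix (Fin (n + 1)) (Fin (n + 1)) (A n)) i j, (M * sigmaR K L) i j = _ :=
    fun M i j => sum_sigmaR (RingHom.id (A n)) hkl.ne j (fun m => M i m)
  simp only [hR, hL, RingHom.id_apply, Matrix.map_apply]
  have hkl' := hkl.ne
  have hlk' := hkl.ne'
  have key' : ∀ i, i = K ∨ i = L ∨ (i < K ∧ i < L ∧ i ≠ K ∧ i ≠ L) ∨
      (K < i ∧ L < i ∧ i ≠ K ∧ i ≠ L) := fun i => by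
    rcases key i with h | h | h | h
    · exact .inl h
    · exact .inr (.inl h)
    · exact .inr (.inr (.inl ⟨h.1, h.2, h.1.ne, h.2.ne⟩))
    · exact .inr (.inr (.inr ⟨h.1, h.2, h.1.ne', h.2.ne'⟩))
  by_cases hij : i = j
  · subst hij
    rcases key' i with rfl | rfl | ⟨h1, h2, h3, h4⟩ | ⟨h1, h2, h3, h4⟩ <;>
    simp (discharger := assumption) only [if_true, if_neg, genA_upper, genA_lower, genA_diag,
      map_neg, AlgEquiv.commutes]
    simp only [Algebra.algebraMap_eq_smul_one, add_smul, neg_mul, mul_neg, smul_mul_assoc,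
      mul_smul_comm, mul_one, add_mul, mul_add, neg_add, sub_mul, smul_neg]
    abel
  have ht : ∀ r : RUV, twist K L hkl.ne (r • a i j) = r • twistVal K L i j := fun r => by
    rw [map_smul, twist_a _ _ _ _ _ hij]
  rcases key' i with rfl | rfl | ⟨hi1, hi2, hi3, hi4⟩ | ⟨hi1, hi2, hi3, hi4⟩ <;>
  rcases key' j with rfl | rfl | ⟨hj1, hj2, hj3, hj4⟩ | ⟨hj1, hj2, hj3, hj4⟩ <;>
  first
  | exact absurd rfl hij
  | (simp only [if_neg hi3, if_neg hi4, if_neg hj3, if_neg hj4]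
     rcases lt_or_gt_of_ne hij with h | h
     · simp only [genA_upper h, ht, twistVal, if_neg hi3, if_neg hi4, if_neg hj3, if_neg hj4]
     · simp only [genA_lower h, ht, twistVal, if_neg hi3, if_neg hi4, if_neg hj3, if_neg hj4])
  | (simp (discharger := assumption) only [if_true, if_neg, genA_upper, genA_lower, genA_diag, ht,
      twistVal]
     try simp only [Algebra.algebraMap_eq_smul_one, add_smul, neg_mul, mul_neg, smul_mul_assoc,
      mul_smul_comm, one_mul, mul_one, add_mul, mul_add, neg_add, smul_sub, smul_neg,
      neg_neg]
     try abel)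

theorem map_phi_sigma_genA {n : ℕ} (c d : RUV) (k : Fin n) :
    (genA n c d).map (phi (sigma k)) = PhiL (sigma k) * genA n c d * PhiR (sigma k) := by
  rw [PhiL_sigma, PhiR_sigma, phi_sigma]
  refine map_twist_genA c d _ _ k.castSucc_lt_succ fun i => ?_
  simp only [Fin.ext_iff, Fin.lt_def, Fin.val_castSucc, Fin.val_succ]
  omega

theorem map_phi_genA {n : ℕ} (c d : RUV) (B : BraidGroup n) :
    (genA n c d).map (phi B) = PhiL B * genA n c d * PhiR B := by
  induction B using braid_group_induction with
  | h1 => ext; simp [PhiL_one, PhiR_one]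
  | hs k => exact map_phi_sigma_genA c d k
  | hmul B C hB hC =>
    have h : (genA n c d).map (phi (B * C)) = ((genA n c d).map (phi C)).map (phi B) := by
      ext; simp
    rw [h, hC, Matrix.map_mul, Matrix.map_mul, hB, PhiL_mul, PhiR_mul]
    simp only [Matrix.mul_assoc]
  -- Apply `φ_{B⁻¹}` to the identity for `B`, then cancel the outer matrices against `Φ^L_{B⁻¹}` and
  -- `Φ^R_{B⁻¹}`.
  | hinv B hB =>
    have h := congrArg (fun M => M.map (phi B⁻¹)) hB
    simp only [Matrix.map_mul, Matrix.map_map, Function.comp_def, phi_inv_phi] at h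
    have hl := map_phi_PhiL_inv_mul B⁻¹
    have hl' := PhiL_mul_map_phi_inv B⁻¹
    have hr' := PhiR_mul_map_phi_inv B⁻¹
    have hr := map_phi_PhiR_inv_mul B⁻¹
    rw [inv_inv] at hl hl' hr hr'
    rw [Matrix.map_id'] at h
    calc (genA n c d).map (phi B⁻¹) = (PhiL B⁻¹ * (PhiL B).map (phi B⁻¹)) *
          (genA n c d).map (phi B⁻¹) * ((PhiR B).map (phi B⁻¹) * PhiR B⁻¹) := by
          rw [hl', hr, one_mul, mul_one]
      _ = PhiL B⁻¹ * ((PhiL B).map (phi B⁻¹) * (genA n c d).map (phi B⁻¹) *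
          (PhiR B).map (phi B⁻¹)) * PhiR B⁻¹ := by simp only [Matrix.mul_assoc]
      _ = PhiL B⁻¹ * genA n c d * PhiR B⁻¹ := by rw [← h]

/-! ### Scalar diagonal matrices and rescaling -/

/-- The diagonal matrix with entries units of the coefficient ring. -/
def scalarDiag {ι : Type} [DecidableEq ι] (S : Type*) [Ring S] [Algebra RUV S] (D : ι → RUVˣ) :
    Matrix ι ι S :=
  Matrix.diagonal fun i => algebraMap RUV S (D i)

section scalarDiag

variable {ι : Type} [DecidableEq ι] {S S' : Type*} [Ring S] [Algebra RUV S] [Ring S']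
  [Algebra RUV S']

theorem scalarDiag_one : scalarDiag S (1 : ι → RUVˣ) = 1 := by
  simp [scalarDiag]

theorem map_scalarDiag {F : Type*} [FunLike F S S'] [AlgHomClass F RUV S S'] (f : F)
    (D : ι → RUVˣ) : (scalarDiag S D).map f = scalarDiag S' D := by
  simp [scalarDiag, Matrix.diagonal_map, AlgHomClass.commutes]

variable [Fintype ι]

theorem scalarDiag_mul (D E : ι → RUVˣ) :
    scalarDiag S (D * E) = scalarDiag S D * scalarDiag S E := by
  simp [scalarDiag]

theorem scalarDiag_mul_apply (D : ι → RUVˣ) (M : Matrix ι ι S) (i j : ι) :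
    (scalarDiag S D * M) i j = (D i : RUV) • M i j := by
  rw [scalarDiag, Matrix.diagonal_mul, Algebra.smul_def]

theorem mul_scalarDiag_apply (D : ι → RUVˣ) (M : Matrix ι ι S) (i j : ι) :
    (M * scalarDiag S D) i j = (D j : RUV) • M i j := by
  rw [scalarDiag, Matrix.mul_diagonal, Algebra.smul_def, Algebra.commutes]

theorem scalarDiag_inv_mul_cancel_left (D : ι → RUVˣ) (M : Matrix ι ι S) :
    scalarDiag S D⁻¹ * (scalarDiag S D * M) = M := by
  rw [← mul_assoc, ← scalarDiag_mul, inv_mul_cancel, scalarDiag_one, one_mul]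

theorem scalarDiag_mul_inv_cancel_left (D : ι → RUVˣ) (M : Matrix ι ι S) :
    scalarDiag S D * (scalarDiag S D⁻¹ * M) = M := by
  rw [← mul_assoc, ← scalarDiag_mul, mul_inv_cancel, scalarDiag_one, one_mul]

theorem scalarDiag_mul_inv_cancel_right (D : ι → RUVˣ) (M : Matrix ι ι S) :
    M * scalarDiag S D * scalarDiag S D⁻¹ = M := by
  rw [mul_assoc, ← scalarDiag_mul, mul_inv_cancel, scalarDiag_one, mul_one]

theorem scalarDiag_inv_mul_cancel_right (D : ι → RUVˣ) (M : Matrix ι ι S) :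
    M * scalarDiag S D⁻¹ * scalarDiag S D = M := by
  rw [mul_assoc, ← scalarDiag_mul, inv_mul_cancel, scalarDiag_one, mul_one]

end scalarDiag

section rescale

variable {ι : Type} [DecidableEq ι]

/-- The rescaling `a_{ij} ↦ T_i⁻¹ T_j a_{ij}`. -/
def rescale (T : ι → RUVˣ) : Alg ι →ₐ[RUV] Alg ι :=
  FreeAlgebra.lift RUV fun p => (((T p.1.1)⁻¹ * T p.1.2 : RUVˣ) : RUV) • a p.1.1 p.1.2

theorem rescale_a (T : ι → RUVˣ) (i j : ι) :
    rescale T (a i j) = (((T i)⁻¹ * T j : RUVˣ) : RUV) • a i j := by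
  by_cases h : i = j
  · simp [a, h]
  · simp [rescale, a, h]

theorem rescale_rescale (T T' : ι → RUVˣ) (x : Alg ι) :
    rescale T (rescale T' x) = rescale (T * T') x := by
  have : (rescale T).comp (rescale T') = rescale (T * T') := by
    apply alg_hom_ext
    intro i j _
    have e : (T' i)⁻¹ * T' j * ((T i)⁻¹ * T j) = ((T * T') i)⁻¹ * (T * T') j := by
      rw [Pi.mul_apply, Pi.mul_apply, mul_inv, mul_mul_mul_comm, mul_comm (T i)⁻¹, mul_comm (T j)]
    rw [AlgHom.comp_apply, rescale_a, rescale_a, map_smul, rescale_a, smul_smul,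
      ← Units.val_mul, e]
  exact DFunLike.congr_fun this x

theorem rescale_one (x : Alg ι) : rescale 1 x = x := by
  have : rescale (1 : ι → RUVˣ) = AlgHom.id RUV (Alg ι) := by
    apply alg_hom_ext
    intro i j _
    simp [rescale_a]
  exact DFunLike.congr_fun this x

theorem map_rescale_sigmaL [Fintype ι] (T : ι → RUVˣ) {k l : ι} (h : k ≠ l) :
    (sigmaL k l).map (rescale T) =
      scalarDiag _ (T ∘ Equiv.swap k l)⁻¹ * sigmaL k l * scalarDiag _ T := by
  ext i j
  simp only [Matrix.map_apply, mul_scalarDiag_apply, scalarDiag_mul_apply, smul_smul,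
    ← Units.val_mul, Pi.inv_apply, Function.comp_apply, sigmaL, Matrix.of_apply]
  split_ifs with h1 h2 h3 h4 h5 h6 <;> subst_vars <;>
    simp [rescale_a, mul_comm, Equiv.swap_apply_of_ne_of_ne, *]

theorem map_rescale_sigmaR [Fintype ι] (T : ι → RUVˣ) {k l : ι} (h : k ≠ l) :
    (sigmaR k l).map (rescale T) =
      scalarDiag _ T⁻¹ * sigmaR k l * scalarDiag _ (T ∘ Equiv.swap k l) := by
  ext i j
  simp only [Matrix.map_apply, mul_scalarDiag_apply, scalarDiag_mul_apply, smul_smul,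
    ← Units.val_mul, Pi.inv_apply, Function.comp_apply, sigmaR, Matrix.of_apply]
  split_ifs with h1 h2 h3 h4 h5 h6 <;> subst_vars <;>
    simp [rescale_a, mul_comm, Equiv.swap_apply_of_ne_of_ne, *]

end rescale

theorem braidPerm_sigma {n : ℕ} (k : Fin n) :
    braidPerm (sigma k) = Equiv.swap k.castSucc k.succ := braidLift_sigma _ _ _ _

theorem map_rescale_genA {n : ℕ} (c d : RUV) (T : Fin (n + 1) → RUVˣ) :
    (genA n c d).map (rescale T) = scalarDiag _ T⁻¹ * genA n c d * scalarDiag _ T := by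
  ext i j
  simp only [Matrix.map_apply, mul_scalarDiag_apply, scalarDiag_mul_apply, smul_smul,
    ← Units.val_mul, Pi.inv_apply]
  rcases lt_trichotomy i j with h | rfl | h
  · simp only [genA_upper h, map_smul, rescale_a, mul_comm (T i)⁻¹]
    exact smul_comm _ _ _
  · simp [genA_diag]
  · simp only [genA_lower h, map_smul, rescale_a, mul_comm (T i)⁻¹]
    exact smul_comm _ _ _

/-- An algebra map out of `𝒜` is determined by its values on the matrix with `c = d = 1`. -/
theorem alg_hom_ext_genA {n : ℕ} {S : Type*} [Ring S] [Algebra RUV S] {f g : A n →ₐ[RUV] S}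
    (h : (genA n 1 1).map f = (genA n 1 1).map g) : f = g := by
  apply alg_hom_ext
  intro i j hij
  have := congrFun (congrFun h i) j
  rcases lt_or_gt_of_ne hij with h | h <;> simpa [genA, h, h.not_gt] using this

/-- The map `φ_B` is determined by `A ↦ Φ^L_B A Φ^R_B` on a single matrix of generators, where the
inner factors `T` and `T⁻¹` cancel. The formulas for `Φ` are hypotheses because this is used inside
the induction that proves them. -/
theorem rescale_phi {n : ℕ} (T : Fin (n + 1) → RUVˣ) (B : BraidGroup n)
    (hL : (PhiL B).map (rescale T) =
      scalarDiag _ (T ∘ braidPerm B)⁻¹ * PhiL B * scalarDiag _ T)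
    (hR : (PhiR B).map (rescale T) =
      scalarDiag _ T⁻¹ * PhiR B * scalarDiag _ (T ∘ braidPerm B)) (x : A n) :
    rescale T (phi B x) = phi B (rescale (T ∘ braidPerm B) x) := by
  have : (rescale T).comp (phi B).toAlgHom =
      (phi B).toAlgHom.comp (rescale (T ∘ braidPerm B)) := by
    apply alg_hom_ext_genA
    have h1 : ∀ f g : A n →ₐ[RUV] A n, (genA n 1 1).map (f.comp g) =
      ((genA n 1 1).map g).map f := fun f g => by ext; simp
    have h2 : ∀ M : Matrix (Fin (n + 1)) (Fin (n + 1)) (A n), M.map (phi B).toAlgHom =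
      M.map (phi B) := fun M => rfl
    rw [h1, h1, h2, h2, map_phi_genA, map_rescale_genA]
    simp only [Matrix.map_mul, map_scalarDiag, map_phi_genA, map_rescale_genA, hL, hR]
    simp only [Matrix.mul_assoc, scalarDiag_mul_inv_cancel_left]
  exact DFunLike.congr_fun this x

/-- By the chain rule it suffices to treat generators, products and inverses. All `T` are treated at
once, since in a product `B C` the formula for `C` is needed at `T ∘ braidPerm B`. -/
theorem map_rescale_Phi {n : ℕ} (B : BraidGroup n) : ∀ (T : Fin (n + 1) → RUVˣ),
    (PhiL B).map (rescale T) =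
      scalarDiag _ (T ∘ braidPerm B)⁻¹ * PhiL B * scalarDiag _ T ∧
    (PhiR B).map (rescale T) =
      scalarDiag _ T⁻¹ * PhiR B * scalarDiag _ (T ∘ braidPerm B) := by
  induction B using braid_group_induction with
  | h1 =>
    intro T
    simp [PhiL_one, PhiR_one, ← scalarDiag_mul, scalarDiag_one]
  | hs k =>
    intro T
    rw [PhiL_sigma, PhiR_sigma, braidPerm_sigma]
    exact ⟨map_rescale_sigmaL T k.castSucc_lt_succ.ne, map_rescale_sigmaR T k.castSucc_lt_succ.ne⟩
  | hmul B C hB hC =>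
    intro T
    have h1 : ∀ M : Matrix (Fin (n + 1)) (Fin (n + 1)) (A n), (M.map (phi B)).map (rescale T) =
        (M.map (rescale (T ∘ braidPerm B))).map (phi B) := fun M => by
      ext; simp [rescale_phi T B (hB T).1 (hB T).2]
    have h2 : T ∘ braidPerm (B * C) = (T ∘ braidPerm B) ∘ braidPerm C := by
      ext; simp
    rw [PhiL_mul, PhiR_mul, h2]
    simp only [Matrix.map_mul, h1, hB T, hC (T ∘ braidPerm B), map_scalarDiag]
    simp only [Matrix.mul_assoc, scalarDiag_mul_inv_cancel_left, and_self]
  | hinv B hB =>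
    intro T
    -- The formula for `B` is used at this `T'`, chosen so that the permutation of `B` turns it back
    -- into `T`.
    set T' := T ∘ braidPerm B⁻¹ with hT'
    have hT : T' ∘ braidPerm B = T := by ext; simp [hT']
    have h1 : ∀ M : Matrix (Fin (n + 1)) (Fin (n + 1)) (A n), (M.map (phi B⁻¹)).map (rescale T) =
        (M.map (rescale T')).map (phi B⁻¹) := fun M => by
      ext i j
      have := rescale_phi T' B (hB T').1 (hB T').2 (phi B⁻¹ (M i j))
      rw [phi_phi_inv, hT] at this
      simp [this]
    obtain ⟨hL, hR⟩ := hB T'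
    have hL' := congrArg (fun M => M.map (phi B⁻¹)) hL
    have hR' := congrArg (fun M => M.map (phi B⁻¹)) hR
    simp only [← h1, hT, Matrix.map_mul, map_scalarDiag] at hL' hR'
    have eL := map_phi_PhiL_inv_mul B⁻¹
    have eL' := PhiL_mul_map_phi_inv B⁻¹
    have eR := map_phi_PhiR_inv_mul B⁻¹
    have eR' := PhiR_mul_map_phi_inv B⁻¹
    rw [inv_inv] at eL eL' eR eR'
    constructor
    · have := congrArg (fun M => M.map (rescale T)) eL
      simp only [Matrix.map_mul, hL', Matrix.map_one, map_zero, map_one] at this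
      -- A known inverse of the rescaled `φ_{B⁻¹}(Φ^L_B)` is inserted on the left; the remaining
      -- product is `1` by `this`.
      have e : (PhiL B⁻¹).map (rescale T) = scalarDiag _ T'⁻¹ * (PhiL B⁻¹ *
        (scalarDiag _ T * ((scalarDiag _ T⁻¹ * (PhiL B).map (phi B⁻¹) * scalarDiag _ T') *
          (PhiL B⁻¹).map (rescale T)))) := by
        simp only [Matrix.mul_assoc, scalarDiag_mul_inv_cancel_left]
        rw [← Matrix.mul_assoc (PhiL B⁻¹), eL', one_mul, scalarDiag_inv_mul_cancel_left]
      rw [e, this, mul_one, Matrix.mul_assoc]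
    · have := congrArg (fun M => M.map (rescale T)) eR'
      simp only [Matrix.map_mul, hR', Matrix.map_one, map_zero, map_one] at this
      have e : (PhiR B⁻¹).map (rescale T) = ((PhiR B⁻¹).map (rescale T) *
        (scalarDiag _ T'⁻¹ * (PhiR B).map (phi B⁻¹) * scalarDiag _ T)) *
          (scalarDiag _ T⁻¹ * PhiR B⁻¹ * scalarDiag _ T') := by
        simp only [Matrix.mul_assoc, scalarDiag_mul_inv_cancel_left]
        rw [← Matrix.mul_assoc _ (PhiR B⁻¹), eR, one_mul, ← scalarDiag_mul, inv_mul_cancel,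
          scalarDiag_one, mul_one]
      rw [e, this, one_mul]

/-! ### Solutions of the relations with a general diagonal matrix -/

/-- The map `f` solves the relations `Â = D Φ^L_B Ǎ` and `Ǎ D = Â Φ^R_B`. -/
structure Solves {n : ℕ} {S : Type*} [Ring S] [Algebra RUV S] (B : BraidGroup n)
    (D : Fin (n + 1) → RUVˣ) (f : A n →ₐ[RUV] S) : Prop where
  left : (Ahat n).map f = scalarDiag S D * ((PhiL B).map f * (Acheck n).map f)
  right : (Acheck n).map f * scalarDiag S D = (Ahat n).map f * (PhiR B).map f

variable {n : ℕ} {S : Type*} [Ring S] [Algebra RUV S]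

theorem Solves.left' {B : BraidGroup n} {D : Fin (n + 1) → RUVˣ} {f : A n →ₐ[RUV] S}
    (h : Solves B D f) :
    (PhiL B).map f * (Acheck n).map f = scalarDiag S D⁻¹ * (Ahat n).map f := by
  rw [h.left, scalarDiag_inv_mul_cancel_left]

/-- In a solution of the relations, the braid action is a rescaling. -/
theorem Solves.phi_eq {B : BraidGroup n} {D : Fin (n + 1) → RUVˣ} {f : A n →ₐ[RUV] S}
    (h : Solves B D f) (x : A n) : f (phi B x) = f (rescale D x) := by
  have hphi : ∀ c d, ((genA n c d).map (phi B)).map f =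
      (PhiL B).map f * (genA n c d).map f * (PhiR B).map f := fun c d => by
    rw [map_phi_genA]; simp only [Matrix.map_mul]
  have hres : ∀ c d, ((genA n c d).map (rescale D)).map f =
      scalarDiag S D⁻¹ * (genA n c d).map f * scalarDiag S D := fun c d => by
    rw [map_rescale_genA]; simp only [Matrix.map_mul, map_scalarDiag]
  -- In the image of `f`: `Φ^L Ǎ Φ^R = D⁻¹ Â Φ^R = D⁻¹ Ǎ D`.
  have h1 : ((Acheck n).map (phi B)).map f = ((Acheck n).map (rescale D)).map f := by
    have := h.left'
    simp only [Acheck_eq] at this ⊢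
    rw [hphi, hres, this, Matrix.mul_assoc, ← h.right, Acheck_eq, Matrix.mul_assoc]
  -- Here the right relation comes first: `Φ^L Â Φ^R = Φ^L Ǎ D = D⁻¹ Â D`.
  have h2 : ((Ahat n).map (phi B)).map f = ((Ahat n).map (rescale D)).map f := by
    have := h.left'
    have h' := h.right
    simp only [Ahat_eq] at this h' ⊢
    rw [hphi, hres, Matrix.mul_assoc, ← h', ← Matrix.mul_assoc, this]
  have : f.comp (phi B).toAlgHom = f.comp (rescale D) := by
    apply alg_hom_ext
    intro i j hij
    simp only [AlgHom.comp_apply, AlgEquiv.toAlgHom_apply]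
    -- Generators above the diagonal are read off from `Ǎ`, where their coefficient is the unit `μ`,
    -- and those below from `Â`, where it is `1`. The other halves have coefficients `μ U` and `V`,
    -- which cannot be cancelled.
    rcases lt_or_gt_of_ne hij with hlt | hlt
    · have := congrFun (congrFun h1 i) j
      simp only [Matrix.map_apply, Acheck_eq, genA_upper hlt, map_smul] at this
      simpa [smul_smul] using congrArg (fun y => ((mu⁻¹ : RUVˣ) : RUV) • y) this
    · have := congrFun (congrFun h2 i) j
      simpa only [Matrix.map_apply, Ahat_eq, genA_lower hlt, map_smul, one_smul] using this
  exact DFunLike.congr_fun this x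

/-- The relations `Â = D Φ^L_B Ǎ` and `Ǎ = Â Φ^R_B D⁻¹`. -/
inductive TwistedRel (B : BraidGroup n) (D : Fin (n + 1) → RUVˣ) : A n → A n → Prop
  | left (i j : Fin (n + 1)) :
    TwistedRel B D ((Ahat n - scalarDiag (A n) D * PhiL B * Acheck n) i j) 0
  | right (i j : Fin (n + 1)) :
    TwistedRel B D ((Acheck n - Ahat n * PhiR B * scalarDiag (A n) D⁻¹) i j) 0

/-- This makes `toHT` the universal solution, so the later arguments can be matrix computations in
an arbitrary target `S`. -/
theorem solves_iff {B : BraidGroup n} {D : Fin (n + 1) → RUVˣ} {f : A n →ₐ[RUV] S} :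
    Solves B D f ↔ ∀ ⦃x y⦄, TwistedRel B D x y → f x = f y := by
  have e1 : (∀ i j, f ((Ahat n - scalarDiag (A n) D * PhiL B * Acheck n) i j) = 0) ↔
      (Ahat n).map f = scalarDiag S D * ((PhiL B).map f * (Acheck n).map f) := by
    have : scalarDiag S D * ((PhiL B).map f * (Acheck n).map f) =
      (scalarDiag (A n) D * PhiL B * Acheck n).map f := by
      simp only [Matrix.map_mul, map_scalarDiag, Matrix.mul_assoc]
    rw [this, ← Matrix.ext_iff]
    simp [sub_eq_zero]
  have e2 : (∀ i j, f ((Acheck n - Ahat n * PhiR B * scalarDiag (A n) D⁻¹) i j) = 0) ↔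
      (Acheck n).map f * scalarDiag S D = (Ahat n).map f * (PhiR B).map f := by
    have : (Ahat n * PhiR B * scalarDiag (A n) D⁻¹).map f =
      (Ahat n).map f * (PhiR B).map f * scalarDiag S D⁻¹ := by
      simp only [Matrix.map_mul, map_scalarDiag]
    have h' : (Acheck n).map f * scalarDiag S D = (Ahat n).map f * (PhiR B).map f ↔
        (Acheck n).map f = (Ahat n * PhiR B * scalarDiag (A n) D⁻¹).map f := by
      rw [this]
      constructor
      · intro h
        rw [← h, scalarDiag_mul_inv_cancel_right]
      · intro h
        rw [h, scalarDiag_inv_mul_cancel_right]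
    rw [h', ← Matrix.ext_iff]
    simp [sub_eq_zero]
  constructor
  · rintro ⟨h1, h2⟩ _ _ (⟨i, j⟩ | ⟨i, j⟩)
    · rw [map_zero]; exact e1.2 h1 i j
    · rw [map_zero]; exact e2.2 h2 i j
  · intro h
    exact ⟨e1.1 fun i j => by rw [h (.left i j), map_zero],
      e2.1 fun i j => by rw [h (.right i j), map_zero]⟩

/-- The quotient of `𝒜` by the relations with a general diagonal matrix. -/
abbrev TwistedHT (B : BraidGroup n) (D : Fin (n + 1) → RUVˣ) : Type := RingQuot (TwistedRel B D)

/-- The quotient map. -/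
def toHT (B : BraidGroup n) (D : Fin (n + 1) → RUVˣ) : A n →ₐ[RUV] TwistedHT B D :=
  RingQuot.mkAlgHom RUV _

theorem solves_toHT (B : BraidGroup n) (D : Fin (n + 1) → RUVˣ) : Solves B D (toHT B D) :=
  solves_iff.2 fun _ _ h => RingQuot.mkAlgHom_rel RUV h

/-- Mutually inverse substitutions that preserve solutions give isomorphic quotients. -/
theorem nonempty_algEquiv {m : ℕ} {B : BraidGroup n} {D : Fin (n + 1) → RUVˣ} {B' : BraidGroup m}
    {D' : Fin (m + 1) → RUVˣ} (F : A n →ₐ[RUV] A m) (G : A m →ₐ[RUV] A n)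
    (hF : Solves B D ((toHT B' D').comp F)) (hG : Solves B' D' ((toHT B D).comp G))
    (hFG : ∀ i j, i ≠ j → toHT B' D' (F (G (a i j))) = toHT B' D' (a i j))
    (hGF : ∀ i j, i ≠ j → toHT B D (G (F (a i j))) = toHT B D (a i j)) :
    Nonempty (TwistedHT B D ≃ₐ[RUV] TwistedHT B' D') := by
  have liftF := RingQuot.liftAlgHom_mkAlgHom_apply RUV ((toHT B' D').comp F) (solves_iff.1 hF)
  have liftG := RingQuot.liftAlgHom_mkAlgHom_apply RUV ((toHT B D).comp G) (solves_iff.1 hG)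
  have hGF' : ((toHT B D).comp G).comp F = toHT B D := alg_hom_ext hGF
  have hFG' : ((toHT B' D').comp F).comp G = toHT B' D' := alg_hom_ext hFG
  refine ⟨AlgEquiv.ofAlgHom (RingQuot.liftAlgHom RUV ⟨_, solves_iff.1 hF⟩)
    (RingQuot.liftAlgHom RUV ⟨_, solves_iff.1 hG⟩) ?_ ?_⟩
  · refine RingQuot.ringQuot_ext' _ _ _ (AlgHom.ext fun x => ?_)
    simp only [AlgHom.comp_apply, AlgHom.id_apply, liftG]
    exact (liftF _).trans (DFunLike.congr_fun hFG' x)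
  · refine RingQuot.ringQuot_ext' _ _ _ (AlgHom.ext fun x => ?_)
    simp only [AlgHom.comp_apply, AlgHom.id_apply, liftF]
    exact (liftG _).trans (DFunLike.congr_fun hGF' x)

/-! ### Moving the base point -/

/-- Rescaling conjugates `Â` and `Ǎ` by `T` but turns `Φ^L` into `(T ∘ π)⁻¹ Φ^L T`, where `π` is the
permutation of `B`. The mismatch on the left is absorbed into `D`. -/
theorem Solves.comp_rescale {B : BraidGroup n} {D : Fin (n + 1) → RUVˣ} {f : A n →ₐ[RUV] S}
    (h : Solves B D f) (T : Fin (n + 1) → RUVˣ) :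
    Solves B (D * T⁻¹ * (T ∘ braidPerm B)) (f.comp (rescale T)) := by
  have e : ∀ M : Matrix (Fin (n + 1)) (Fin (n + 1)) (A n), M.map (f.comp (rescale T)) =
    (M.map (rescale T)).map f := fun M => by ext; simp
  have hl := h.left
  have hr := h.right
  rw [Ahat_eq, Acheck_eq] at hl hr
  constructor
  · simp only [e, Ahat_eq, Acheck_eq, map_rescale_genA, (map_rescale_Phi B T).1, Matrix.map_mul,
      map_scalarDiag]
    rw [hl]
    simp only [← Matrix.mul_assoc, scalarDiag_mul_inv_cancel_right, ← scalarDiag_mul]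
    congr 4
    rw [mul_inv_cancel_right, mul_comm]
  · simp only [e, Ahat_eq, Acheck_eq, map_rescale_genA, (map_rescale_Phi B T).2, Matrix.map_mul,
      map_scalarDiag]
    simp only [Matrix.mul_assoc, scalarDiag_mul_inv_cancel_left, ← scalarDiag_mul]
    rw [← Matrix.mul_assoc ((genA _ _ _).map f), ← hr, Matrix.mul_assoc, ← scalarDiag_mul]
    congr 3
    rw [← mul_assoc, ← mul_assoc, mul_comm T D, mul_inv_cancel_right]

theorem twistedHT_rescale (B : BraidGroup n) (D T : Fin (n + 1) → RUVˣ) :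
    Nonempty (TwistedHT B D ≃ₐ[RUV] TwistedHT B (D * T⁻¹ * (T ∘ braidPerm B))) := by
  refine nonempty_algEquiv (rescale T⁻¹) (rescale T) ?_ ((solves_toHT B D).comp_rescale T)
    (fun i j _ => ?_) fun i j _ => ?_
  · have := (solves_toHT B (D * T⁻¹ * (T ∘ braidPerm B))).comp_rescale T⁻¹
    have e : D * T⁻¹ * (T ∘ braidPerm B) * T⁻¹⁻¹ * (T⁻¹ ∘ braidPerm B) = D := by
      ext i : 1
      simp only [Pi.mul_apply, Pi.inv_apply, Function.comp_apply, inv_inv]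
      rw [mul_right_comm, mul_inv_cancel_right, inv_mul_cancel_right]
    rwa [e] at this
  · rw [rescale_rescale, inv_mul_cancel, rescale_one]
  · rw [rescale_rescale, mul_inv_cancel, rescale_one]

theorem twistedHT_mulSingle_perm (B : BraidGroup n) (p : Fin (n + 1)) (g : RUVˣ) :
    Nonempty (TwistedHT B (Pi.mulSingle (braidPerm B p) g) ≃ₐ[RUV]
      TwistedHT B (Pi.mulSingle p g)) := by
  -- With `T = D` the factor `D T⁻¹` disappears and only `T ∘ braidPerm B` is left, whose nontrivial
  -- entry is at `p`.
  have h := twistedHT_rescale B (Pi.mulSingle (braidPerm B p) g) (Pi.mulSingle (braidPerm B p) g)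
  have e : (Pi.mulSingle (braidPerm B p) g : Fin (n + 1) → RUVˣ) ∘ braidPerm B =
      Pi.mulSingle p g := by
    ext i
    simp [Pi.mulSingle_apply]
  rwa [mul_inv_cancel, one_mul, e] at h

/-- The nontrivial entry travels along a cycle of the permutation, and for a knot there is only one
cycle. -/
theorem twistedHT_mulSingle_of_isKnot {B : BraidGroup n} (hB : ClosureIsKnot B)
    (p q : Fin (n + 1)) (g : RUVˣ) :
    Nonempty (TwistedHT B (Pi.mulSingle p g) ≃ₐ[RUV] TwistedHT B (Pi.mulSingle q g)) := by
  obtain ⟨k, rfl⟩ := (hB q p).exists_nat_pow_eq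
  induction k with
  | zero => exact ⟨AlgEquiv.refl⟩
  | succ k ih =>
    obtain ⟨e⟩ := ih
    obtain ⟨e'⟩ := twistedHT_mulSingle_perm B ((braidPerm B ^ k) q) g
    rw [pow_succ', Equiv.Perm.mul_apply]
    exact ⟨e'.trans e⟩

/-! ### Conjugation -/

/-- After `φ_C`, the matrix `Φ^L` of `C⁻¹ B C` is `φ_B(Φ^L_C) Φ^L_B (Φ^L_C)⁻¹`. By `Solves.phi_eq`,
`f` turns its first factor into `(D ∘ π_C)⁻¹ Φ^L_C D`, where `π_C` is the permutation of `C`. The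
product with `φ_C(Ǎ) = Φ^L_C Ǎ Φ^R_C` then telescopes to `Φ^L_C Â Φ^R_C = φ_C(Â)`; the right
relation is similar. -/
theorem Solves.comp_phi {B : BraidGroup n} {D : Fin (n + 1) → RUVˣ} {f : A n →ₐ[RUV] S}
    (h : Solves B D f) (C : BraidGroup n) :
    Solves (C⁻¹ * B * C) (D ∘ braidPerm C) (f.comp (phi C).toAlgHom) := by
  have e : ∀ M : Matrix (Fin (n + 1)) (Fin (n + 1)) (A n), M.map (f.comp (phi C).toAlgHom) =
    (M.map (phi C)).map f := fun M => by ext; simp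
  have e' : ∀ M : Matrix (Fin (n + 1)) (Fin (n + 1)) (A n), (M.map (phi B)).map f =
    (M.map (rescale D)).map f := fun M => by ext; simp [h.phi_eq]
  have hc : ∀ M : Matrix (Fin (n + 1)) (Fin (n + 1)) (A n),
      (M.map (phi (C⁻¹ * B))).map (phi C) = M.map (phi B) := fun M => by
    ext; simp [← AlgEquiv.mul_apply]
  have hc' : ∀ M : Matrix (Fin (n + 1)) (Fin (n + 1)) (A n),
      (M.map (phi C⁻¹)).map (phi C) = M := fun M => by
    ext; simp
  have hL : ((PhiL (C⁻¹ * B * C)).map (phi C)) =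
      (PhiL C).map (phi B) * (PhiL B * (PhiL C⁻¹).map (phi C)) := by
    rw [PhiL_mul, PhiL_mul]; simp only [Matrix.map_mul, hc, hc']
  have hR : ((PhiR (C⁻¹ * B * C)).map (phi C)) =
      (PhiR C⁻¹).map (phi C) * PhiR B * (PhiR C).map (phi B) := by
    rw [PhiR_mul, PhiR_mul]; simp only [Matrix.map_mul, hc, hc']
  have cL := congrArg (fun M => M.map f) (map_phi_PhiL_inv_mul C)
  have cR := congrArg (fun M => M.map f) (PhiR_mul_map_phi_inv C)
  simp only [Matrix.map_mul, Matrix.map_one, map_zero, map_one] at cL cR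
  have hl := h.left'
  have hr := h.right
  rw [Ahat_eq, Acheck_eq] at hl hr
  constructor
  · rw [e, e, e, hL]
    simp only [Ahat_eq, Acheck_eq, map_phi_genA, Matrix.map_mul, e', (map_rescale_Phi C D).1,
      map_scalarDiag, ← Matrix.mul_assoc]
    rw [← scalarDiag_mul, mul_inv_cancel, scalarDiag_one, one_mul]
    congr 1
    simp only [Matrix.mul_assoc]
    rw [← Matrix.mul_assoc _ ((PhiL C).map f), cL, one_mul, hl, scalarDiag_mul_inv_cancel_left]
  · rw [e, e, e, hR]
    simp only [Ahat_eq, Acheck_eq, map_phi_genA, Matrix.map_mul, e', (map_rescale_Phi C D).2,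
      map_scalarDiag, Matrix.mul_assoc]
    congr 1
    rw [← Matrix.mul_assoc ((PhiR C).map f), cR, one_mul, ← Matrix.mul_assoc _ ((PhiR B).map f),
      ← hr]
    simp only [Matrix.mul_assoc, scalarDiag_mul_inv_cancel_left]

theorem twistedHT_conj (B C : BraidGroup n) (D : Fin (n + 1) → RUVˣ) :
    Nonempty (TwistedHT B D ≃ₐ[RUV] TwistedHT (C⁻¹ * B * C) (D ∘ braidPerm C)) := by
  refine nonempty_algEquiv (phi C⁻¹).toAlgHom (phi C).toAlgHom ?_ ((solves_toHT B D).comp_phi C)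
    (fun i j _ => by simp [phi_inv_phi, -map_inv]) fun i j _ => by simp [phi_phi_inv, -map_inv]
  have := (solves_toHT (C⁻¹ * B * C) (D ∘ braidPerm C)).comp_phi C⁻¹
  have e : (D ∘ braidPerm C) ∘ braidPerm C⁻¹ = D := by ext; simp
  rw [e] at this
  simpa only [inv_inv, mul_assoc, mul_inv_cancel_left, mul_inv_cancel, mul_one] using this

/-! ### The matrices of a braid with a trivial strand added -/

/-- The block diagonal matrix with blocks `M` and `1`. -/
def extendOne {n : ℕ} (M : Matrix (Fin (n + 1)) (Fin (n + 1)) (A n)) :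
    Matrix (Fin (n + 2)) (Fin (n + 2)) (A (n + 1)) :=
  Matrix.of fun i j => Fin.lastCases (motive := fun _ => A (n + 1))
    (if j = Fin.last (n + 1) then 1 else 0)
    (fun i => Fin.lastCases (motive := fun _ => A (n + 1)) 0 (fun j => incl (M i j)) j) i

section extendOne

variable {n : ℕ} (M N : Matrix (Fin (n + 1)) (Fin (n + 1)) (A n))

@[simp] theorem extendOne_castSucc_castSucc (i j : Fin (n + 1)) :
    extendOne M i.castSucc j.castSucc = incl (M i j) := by simp [extendOne]

@[simp] theorem extendOne_castSucc_last (i : Fin (n + 1)) :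
    extendOne M i.castSucc (Fin.last (n + 1)) = 0 := by simp [extendOne]

@[simp] theorem extendOne_last_castSucc (j : Fin (n + 1)) :
    extendOne M (Fin.last (n + 1)) j.castSucc = 0 := by
  simp [extendOne, j.castSucc_lt_last.ne]

@[simp] theorem extendOne_last_last :
    extendOne M (Fin.last (n + 1)) (Fin.last (n + 1)) = 1 := by simp [extendOne]

theorem matrix_ext_lastCases {α : Type*} {P Q : Matrix (Fin (n + 2)) (Fin (n + 2)) α}
    (h1 : ∀ i j : Fin (n + 1), P i.castSucc j.castSucc = Q i.castSucc j.castSucc)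
    (h2 : ∀ i : Fin (n + 1), P i.castSucc (Fin.last _) = Q i.castSucc (Fin.last _))
    (h3 : ∀ j : Fin (n + 1), P (Fin.last _) j.castSucc = Q (Fin.last _) j.castSucc)
    (h4 : P (Fin.last _) (Fin.last _) = Q (Fin.last _) (Fin.last _)) : P = Q := by
  ext i j
  induction i using Fin.lastCases <;> induction j using Fin.lastCases <;> simp only [h1, h2, h3, h4]

theorem extendOne_mul : extendOne (M * N) = extendOne M * extendOne N := by
  apply matrix_ext_lastCases <;> simp [Matrix.mul_apply, Fin.sum_univ_castSucc]

theorem extendOne_one : extendOne (1 : Matrix (Fin (n + 1)) (Fin (n + 1)) (A n)) = 1 := by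
  apply matrix_ext_lastCases <;>
    simp [Matrix.one_apply, apply_ite incl, (Fin.castSucc_lt_last _).ne,
      (Fin.castSucc_lt_last _).ne']

theorem extendOne_map_phi (B : BraidGroup n) :
    extendOne (M.map (phi B)) = (extendOne M).map (phi (addStrand B)) := by
  have : ∀ x, phi (addStrand B) (incl x) = incl (phi B x) := phiExt_incl B
  apply matrix_ext_lastCases <;> simp [this]

end extendOne

theorem addStrand_sigma {n : ℕ} (k : Fin n) : addStrand (sigma k) = sigma k.castSucc :=
  braidLift_sigma _ _ _ _

theorem Phi_addStrand {n : ℕ} (B : BraidGroup n) :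
    PhiL (addStrand B) = extendOne (PhiL B) ∧ PhiR (addStrand B) = extendOne (PhiR B) := by
  induction B using braid_group_induction with
  | h1 => simp [PhiL_one, PhiR_one, extendOne_one]
  | hs k =>
    rw [addStrand_sigma, PhiL_sigma, PhiL_sigma, PhiR_sigma, PhiR_sigma, Fin.succ_castSucc]
    have h1 := incl_a _ _ k.castSucc_lt_succ.ne
    have h2 := incl_a _ _ k.castSucc_lt_succ.ne'
    have h3 := (Fin.castSucc_lt_last k.castSucc).ne
    have h4 := (Fin.castSucc_lt_last k.succ).ne
    constructor <;> apply matrix_ext_lastCases <;> intros <;>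
      simp only [extendOne_castSucc_castSucc, extendOne_castSucc_last, extendOne_last_castSucc,
        extendOne_last_last, sigmaL, sigmaR, Matrix.of_apply, Fin.castSucc_inj, apply_ite incl,
        map_neg, map_zero, map_one, h1, h2, h3.symm, h4.symm, if_false,
        (Fin.castSucc_lt_last _).ne, (Fin.castSucc_lt_last _).ne', ite_self, if_true]
  | hmul B C hB hC =>
    rw [map_mul, PhiL_mul, PhiL_mul, PhiR_mul, PhiR_mul, extendOne_mul, extendOne_mul,
      extendOne_map_phi, extendOne_map_phi, hB.1, hB.2, hC.1, hC.2]
    exact ⟨rfl, rfl⟩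
  | hinv B hB =>
    have hL := congrArg extendOne (map_phi_PhiL_inv_mul B)
    have hR := congrArg extendOne (PhiR_mul_map_phi_inv B)
    have hL' := PhiL_mul_map_phi_inv (addStrand B)
    have hR' := map_phi_PhiR_inv_mul (addStrand B)
    rw [extendOne_mul, extendOne_map_phi, extendOne_one, ← hB.1] at hL
    rw [extendOne_mul, extendOne_map_phi, extendOne_one, ← hB.2] at hR
    have inj : ∀ M N : Matrix (Fin (n + 2)) (Fin (n + 2)) (A (n + 1)),
        M.map (phi (addStrand B)) = N.map (phi (addStrand B)) → M = N := fun M N h =>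
      Matrix.map_injective (phi (addStrand B)).injective h
    -- After applying the injective `φ`, both candidates are one-sided inverses of the same matrix,
    -- on opposite sides, hence equal.
    rw [map_inv]
    exact ⟨inj _ _ (left_inv_eq_right_inv hL hL').symm,
      inj _ _ (left_inv_eq_right_inv hR' hR)⟩

/-! ### Positive stabilization -/

theorem units_smul_cancel {S : Type*} [Ring S] [Algebra RUV S] (u : RUVˣ) {x y : S}
    (h : (u : RUV) • x = (u : RUV) • y) : x = y := by
  simpa [smul_smul] using congrArg (fun y => ((u⁻¹ : RUVˣ) : RUV) • y) h

/-! ### Elimination of the new generators, as matrix algebra over an arbitrary target. -/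

section stabilization

variable {ι S : Type*} [Fintype ι] [Ring S] [Algebra RUV S]

/-- The entries of the relations of a stabilized braid, in terms of the images of
`Φ^L, Φ^R, Â, Ǎ` of the original braid and of the new generators `a_{i*}` and `a_{*j}`. -/
structure StabRelations (e : ι) (d μ : RUVˣ) (U V : RUV) (PL PR H C : Matrix ι ι S)
    (X Y : ι → S) : Prop where
  left_old : ∀ i ≠ e, ∀ j, H i j = (PL * C) i j
  left_new : ∀ i ≠ e, ((μ : RUV) * U) • X i = (μ : RUV) • ∑ l, PL i l * X l
  left_pt_old : ∀ j, H e j = (d : RUV) • (-(∑ l, Y l * PR l e) * (PL * C) e j - V • Y j)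
  left_pt_new : ((μ : RUV) * U) • X e = (d : RUV) •
    (-(∑ l, Y l * PR l e) * ((μ : RUV) • ∑ l, PL e l * X l) + (V + μ) • 1)
  left_last_old : ∀ j, Y j = (PL * C) e j
  left_last_new : -((1 + (μ : RUV) * U) • (1 : S)) = (μ : RUV) • ∑ l, PL e l * X l
  right_old : ∀ i, ∀ j ≠ e, C i j = (H * PR) i j
  right_new : ∀ j ≠ e, V • Y j = ∑ l, Y l * PR l j
  right_pt_old : ∀ i, (d : RUV) • C i e =
    -((H * PR) i e * ∑ l, PL e l * X l) - ((μ : RUV) * U) • X i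
  right_pt_new : (d : RUV) • V • Y e =
    -((∑ l, Y l * PR l e) * ∑ l, PL e l * X l) + (1 + (μ : RUV) * U) • 1
  right_last_old : ∀ i, (μ : RUV) • X i = (H * PR) i e
  right_last_new : -((V + μ) • (1 : S)) = ∑ l, Y l * PR l e

/-- The two corner relations give `∑ Y_l PR_{le} = -(V + μ)` and `μ ∑ PL_{el} X_l = -(1 + μ U)`.
Substituting these scalars makes the quadratic relations at `e` linear, and they become the
relations of the original braid with `d μ` at `e`. Conversely, the formulas for `X` and `Y` imply
both scalar identities and then all the rest. The hypotheses `hH` and `hC` reflect that `e` is the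
last index: its column lies above the diagonal and its row below. -/
theorem stabRelations_iff (e : ι) (d μ : RUVˣ) (U V : RUV) (PL PR H C : Matrix ι ι S)
    (X Y : ι → S) (hH : ∀ i ≠ e, H i e = U • C i e) (hC : ∀ j ≠ e, C e j = V • H e j)
    (hHe : H e e = -((1 + (μ : RUV) * U) • 1)) (hCe : C e e = -((V + μ) • 1)) :
    StabRelations e d μ U V PL PR H C X Y ↔
      ((∀ i ≠ e, ∀ j, H i j = (PL * C) i j) ∧
        ∀ j, H e j = ((d * μ : RUVˣ) : RUV) • (PL * C) e j) ∧
      ((∀ i, ∀ j ≠ e, C i j = (H * PR) i j) ∧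
        ∀ i, ((d * μ : RUVˣ) : RUV) • C i e = (H * PR) i e) ∧
      (∀ i, X i = (d : RUV) • C i e) ∧ ∀ j, ((d * μ : RUVˣ) : RUV) • Y j = H e j := by
  constructor
  · intro h
    have hl : ∀ j, H e j = ((d * μ : RUVˣ) : RUV) • (PL * C) e j := fun j => by
      rw [h.left_pt_old j, ← h.right_last_new, h.left_last_old j, Units.val_mul]
      simp only [neg_neg, smul_mul_assoc, one_mul]
      module
    have hr : ∀ i, ((d * μ : RUVˣ) : RUV) • C i e = (H * PR) i e := fun i => by
      have h1 := congrArg (fun x => (μ : RUV) • x) (h.right_pt_old i)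
      have h2 : (μ : RUV) • ((H * PR) i e * ∑ l, PL e l * X l) =
          -((1 + (μ : RUV) * U) • (H * PR) i e) := by
        rw [← mul_smul_comm, ← h.left_last_new]
        simp
      simp only [smul_sub, smul_neg, h2, smul_comm (μ : RUV) ((μ : RUV) * U) (X i),
        h.right_last_old] at h1
      rw [Units.val_mul, mul_comm, mul_smul, h1]
      module
    refine ⟨⟨h.left_old, hl⟩, ⟨h.right_old, hr⟩, fun i => ?_, fun j => ?_⟩
    · apply units_smul_cancel μ
      rw [h.right_last_old, ← hr, smul_smul, Units.val_mul, mul_comm]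
    · rw [hl, h.left_last_old]
  · rintro ⟨⟨hl1, hl2⟩, ⟨hr1, hr2⟩, hX, hY⟩
    have hu : ∀ i, ∑ l, PL i l * X l = (d : RUV) • (PL * C) i e := fun i => by
      simp only [hX, mul_smul_comm, Matrix.mul_apply, Finset.smul_sum]
    have hv : ∀ j, ((d * μ : RUVˣ) : RUV) • ∑ l, Y l * PR l j = (H * PR) e j := fun j => by
      simp only [Finset.smul_sum, ← smul_mul_assoc, hY, Matrix.mul_apply]
    have hYW : ∀ j, Y j = (PL * C) e j := fun j => by
      apply units_smul_cancel (d * μ)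
      rw [hY, hl2]
    -- Multiplied by `d μ`, the sum becomes `(H PR)_{ee} = d μ C_{ee}`, and `C_{ee} = -(V + μ)`.
    have hye : -((V + μ) • (1 : S)) = ∑ l, Y l * PR l e := by
      apply units_smul_cancel (d * μ)
      rw [hv, ← hr2, hCe]
    have hue : -((1 + (μ : RUV) * U) • (1 : S)) = (μ : RUV) • ∑ l, PL e l * X l := by
      rw [hu, ← hHe, hl2, smul_smul, Units.val_mul, mul_comm]
    have hXZ : ∀ i, (μ : RUV) • X i = (H * PR) i e := fun i => by
      rw [hX, ← hr2, smul_smul, Units.val_mul, mul_comm]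
    have hZu : ∀ x : S, (μ : RUV) • (x * ∑ l, PL e l * X l) = -((1 + (μ : RUV) * U) • x) :=
      fun x => by
        rw [← mul_smul_comm, ← hue]
        simp
    refine ⟨hl1, fun i hi => ?_, fun j => ?_, ?_, hYW, hue, hr1, fun j hj => ?_, fun i => ?_, ?_,
      hXZ, hye⟩
    · rw [hu, ← hl1 i hi, hH i hi, hX]
      module
    · rw [hl2, ← hye, ← hYW, Units.val_mul]
      simp only [neg_neg, smul_mul_assoc, one_mul]
      module
    · rw [← hye, ← hue, hX, hCe]
      simp only [neg_neg, smul_mul_assoc, one_mul]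
      module
    · apply units_smul_cancel (d * μ)
      rw [hv, ← hr1 _ j hj, smul_comm, hY, hC j hj]
    · apply units_smul_cancel μ
      rw [smul_sub, smul_neg, hZu, ← hXZ]
      simp only [hX]
      module
    · apply units_smul_cancel μ
      have := hY e
      rw [hHe, Units.val_mul] at this
      have e1 : (μ : RUV) • (d : RUV) • V • Y e = V • ((d : RUV) * μ) • Y e := by module
      rw [smul_add, smul_neg, hZu, ← hye, e1, this]
      module

end stabilization

/-! ### Block form of the relations of a stabilized braid. -/

section genA_succ

variable {n : ℕ} (c d : RUV)

theorem genA_castSucc_castSucc (i j : Fin (n + 1)) :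
    genA (n + 1) c d i.castSucc j.castSucc = incl (genA n c d i j) := by
  rcases lt_trichotomy i j with h | rfl | h
  · rw [genA_upper h, genA_upper (Fin.castSucc_lt_castSucc_iff.2 h), map_smul, incl_a _ _ h.ne]
  · rw [genA_diag, genA_diag, map_neg, AlgHom.commutes]
  · rw [genA_lower h, genA_lower (Fin.castSucc_lt_castSucc_iff.2 h), map_smul, incl_a _ _ h.ne']

theorem genA_castSucc_last (i : Fin (n + 1)) :
    genA (n + 1) c d i.castSucc (Fin.last _) = c • a i.castSucc (Fin.last _) :=
  genA_upper i.castSucc_lt_last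

theorem genA_last_castSucc (j : Fin (n + 1)) :
    genA (n + 1) c d (Fin.last _) j.castSucc = d • a (Fin.last _) j.castSucc :=
  genA_lower j.castSucc_lt_last

end genA_succ

theorem matrix_ext_iff_lastCases {α : Type*} {P Q : Matrix (Fin (n + 2)) (Fin (n + 2)) α} :
    P = Q ↔ (∀ i j : Fin (n + 1), P i.castSucc j.castSucc = Q i.castSucc j.castSucc) ∧
      (∀ i : Fin (n + 1), P i.castSucc (Fin.last _) = Q i.castSucc (Fin.last _)) ∧
      (∀ j : Fin (n + 1), P (Fin.last _) j.castSucc = Q (Fin.last _) j.castSucc) ∧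
      P (Fin.last _) (Fin.last _) = Q (Fin.last _) (Fin.last _) :=
  ⟨fun h => by simp [h], fun h => matrix_ext_lastCases h.1 h.2.1 h.2.2.1 h.2.2.2⟩

theorem PhiL_stab (B : BraidGroup n) : PhiL (addStrand B * sigma (Fin.last n)) =
    (sigmaL (Fin.last n).castSucc (Fin.last (n + 1))).map (phi (addStrand B)) *
      extendOne (PhiL B) := by
  rw [PhiL_mul, PhiL_sigma, (Phi_addStrand B).1, Fin.succ_last]

theorem PhiR_stab (B : BraidGroup n) : PhiR (addStrand B * sigma (Fin.last n)) =
    extendOne (PhiR B) *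
      (sigmaR (Fin.last n).castSucc (Fin.last (n + 1))).map (phi (addStrand B)) := by
  rw [PhiR_mul, PhiR_sigma, (Phi_addStrand B).2, Fin.succ_last]

/-- The matrix equations are split into the blocks given by the old strands and the new one, and the
row or column of the strand that meets the new crossing is split off from the old ones. -/
theorem solves_stab_iff_stabRelations (B : BraidGroup n) (d : RUVˣ) (f : A (n + 1) →ₐ[RUV] S) :
    Solves (addStrand B * sigma (Fin.last n)) (Pi.mulSingle (Fin.last n).castSucc d) f ↔
      StabRelations (Fin.last n) d mu varU varV ((PhiL B).map (f.comp incl))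
        ((PhiR B).map (f.comp incl)) ((Ahat n).map (f.comp incl)) ((Acheck n).map (f.comp incl))
        (fun i => f (a i.castSucc (Fin.last (n + 1))))
        (fun j => f (a (Fin.last (n + 1)) j.castSucc)) := by
  have hne : (Fin.last n).castSucc ≠ Fin.last (n + 1) := (Fin.castSucc_lt_last _).ne
  -- The chain rule applies `φ` of the extended braid to the matrices of the new generator. Their
  -- nonconstant entries are single generators joining the last old strand and the new one, so the
  -- definition of `Φ^R_B` and `Φ^L_B` expands their images.
  set g : A (n + 1) →+* S := (f.comp (phi (addStrand B)).toAlgHom).toRingHom with hg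
  have hgY : g (a (Fin.last (n + 1)) (Fin.last n).castSucc) =
      ∑ l : Fin (n + 1), f (a (Fin.last (n + 1)) l.castSucc) *
        f (incl (PhiR B l (Fin.last n))) := by
    have := congrArg f (PhiR_spec B (Fin.last n))
    rw [map_sum] at this
    simp only [map_mul] at this
    exact this
  have hgX : g (a (Fin.last n).castSucc (Fin.last (n + 1))) =
      ∑ l : Fin (n + 1), f (incl (PhiL B (Fin.last n) l)) * f (a l.castSucc (Fin.last (n + 1))) := by
    have := congrArg f (PhiL_spec B (Fin.last n))
    rw [map_sum] at this
    simp only [map_mul] at this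
    exact this
  have hL : ∀ (N : Matrix (Fin (n + 2)) (Fin (n + 2)) S) i j,
      ((PhiL (addStrand B * sigma (Fin.last n))).map f * N) i j =
      if i = (Fin.last n).castSucc then
        -g (a (Fin.last (n + 1)) (Fin.last n).castSucc) *
          ((extendOne (PhiL B)).map f * N) (Fin.last n).castSucc j -
          ((extendOne (PhiL B)).map f * N) (Fin.last (n + 1)) j
      else if i = Fin.last (n + 1) then
        ((extendOne (PhiL B)).map f * N) (Fin.last n).castSucc j
      else ((extendOne (PhiL B)).map f * N) i j := fun N i j => by
    rw [PhiL_stab, Matrix.map_mul, Matrix.mul_assoc]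
    exact sum_sigmaL g hne i fun m => ((extendOne (PhiL B)).map f * N) m j
  have hR : ∀ (N : Matrix (Fin (n + 2)) (Fin (n + 2)) S) i j,
      (N * (PhiR (addStrand B * sigma (Fin.last n))).map f) i j =
      if j = (Fin.last n).castSucc then
        -((N * (extendOne (PhiR B)).map f) i (Fin.last n).castSucc *
          g (a (Fin.last n).castSucc (Fin.last (n + 1)))) -
          (N * (extendOne (PhiR B)).map f) i (Fin.last (n + 1))
      else if j = Fin.last (n + 1) then
        (N * (extendOne (PhiR B)).map f) i (Fin.last n).castSucc
      else (N * (extendOne (PhiR B)).map f) i j := fun N i j => by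
    rw [PhiR_stab, Matrix.map_mul, ← Matrix.mul_assoc]
    exact sum_sigmaR g hne j fun m => (N * (extendOne (PhiR B)).map f) i m
  have hE1 : ∀ (N : Matrix (Fin (n + 2)) (Fin (n + 2)) S) (i : Fin (n + 1)) j,
      ((extendOne (PhiL B)).map f * N) i.castSucc j =
        ∑ l, f (incl (PhiL B i l)) * N l.castSucc j := fun N i j => by
    simp [Matrix.mul_apply, Fin.sum_univ_castSucc]
  have hE2 : ∀ (N : Matrix (Fin (n + 2)) (Fin (n + 2)) S) j,
      ((extendOne (PhiL B)).map f * N) (Fin.last _) j = N (Fin.last _) j := fun N j => by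
    simp [Matrix.mul_apply, Fin.sum_univ_castSucc]
  have hE3 : ∀ (N : Matrix (Fin (n + 2)) (Fin (n + 2)) S) (j : Fin (n + 1)) i,
      (N * (extendOne (PhiR B)).map f) i j.castSucc =
        ∑ l, N i l.castSucc * f (incl (PhiR B l j)) := fun N i j => by
    simp [Matrix.mul_apply, Fin.sum_univ_castSucc]
  have hE4 : ∀ (N : Matrix (Fin (n + 2)) (Fin (n + 2)) S) i,
      (N * (extendOne (PhiR B)).map f) i (Fin.last _) = N i (Fin.last _) := fun N i => by
    simp [Matrix.mul_apply, Fin.sum_univ_castSucc]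
  have hsingle : ∀ i : Fin (n + 1), i ≠ Fin.last n →
      (Pi.mulSingle (Fin.last n).castSucc d : Fin (n + 2) → RUVˣ) i.castSucc = 1 := fun i hi => by
    simp [hi]
  have hlast : (Pi.mulSingle (Fin.last n).castSucc d : Fin (n + 2) → RUVˣ) (Fin.last (n + 1)) = 1 :=
    by simp [hne.symm]
  have hcl : ∀ i : Fin (n + 1), i.castSucc ≠ Fin.last (n + 1) := fun i => i.castSucc_lt_last.ne
  have hsmulL : ∀ (r : RUV) (i : Fin (n + 1)), ∑ l, f (incl (PhiL B i l)) *
      r • f (a l.castSucc (Fin.last (n + 1))) =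
      r • ∑ l, f (incl (PhiL B i l)) * f (a l.castSucc (Fin.last (n + 1))) := fun r i => by
    simp only [mul_smul_comm, Finset.smul_sum]
  have hleft : (Ahat (n + 1)).map f = scalarDiag S (Pi.mulSingle (Fin.last n).castSucc d) *
      ((PhiL (addStrand B * sigma (Fin.last n))).map f * (Acheck (n + 1)).map f) ↔ _ :=
    matrix_ext_iff_lastCases
  have hright : (Acheck (n + 1)).map f * scalarDiag S (Pi.mulSingle (Fin.last n).castSucc d) =
      (Ahat (n + 1)).map f * (PhiR (addStrand B * sigma (Fin.last n))).map f ↔ _ :=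
    matrix_ext_iff_lastCases
  simp only [scalarDiag_mul_apply, mul_scalarDiag_apply, hL, hR, Ahat_eq, Acheck_eq,
    Fin.castSucc_inj, hcl, hne.symm, hlast, if_false, if_true, hE1, hE2, hE3, hE4,
    Matrix.map_apply, genA_castSucc_castSucc, genA_castSucc_last, genA_last_castSucc, hgX, hgY,
    genA_diag, Units.val_one, one_smul, map_smul, hsmulL, map_neg, map_one,
    Algebra.algebraMap_eq_smul_one, sub_neg_eq_add, add_comm (mu : RUV) varV,
    add_comm ((mu : RUV) * varU) 1] at hleft hright
  have hpt : (Pi.mulSingle (Fin.last n).castSucc d : Fin (n + 2) → RUVˣ) (Fin.last n).castSucc =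
      d :=
    Pi.mulSingle_eq_same _ _
  rw [Ahat_eq, Acheck_eq]
  constructor
  · intro h
    have hl := h.left
    have hr := h.right
    rw [Ahat_eq, Acheck_eq] at hl hr
    obtain ⟨l1, l2, l3, l4⟩ := hleft.1 hl
    obtain ⟨r1, r2, r3, r4⟩ := hright.1 hr
    refine ⟨fun i hi j => ?_, fun i hi => ?_, fun j => ?_, ?_, l3, l4, fun i j hj => ?_,
      fun j hj => ?_, fun i => ?_, ?_, r2, r4⟩
    · have := l1 i j
      rwa [if_neg hi, hsingle i hi, Units.val_one, one_smul] at this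
    · have := l2 i
      rwa [if_neg hi, hsingle i hi, Units.val_one, one_smul] at this
    · have := l1 (Fin.last n) j
      rwa [if_pos rfl, hpt] at this
    · have := l2 (Fin.last n)
      rwa [if_pos rfl, hpt] at this
    · have := r1 i j
      rwa [if_neg hj, hsingle j hj, Units.val_one, one_smul] at this
    · have := r3 j
      rwa [if_neg hj, hsingle j hj, Units.val_one, one_smul] at this
    · have := r1 i (Fin.last n)
      rwa [if_pos rfl, hpt] at this
    · have := r3 (Fin.last n)
      rwa [if_pos rfl, hpt] at this
  · intro h
    constructor <;> rw [Ahat_eq, Acheck_eq]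
    · refine hleft.2 ⟨fun i j => ?_, fun i => ?_, h.left_last_old, h.left_last_new⟩
      · split_ifs with hi
        · subst hi; rw [hpt]; exact h.left_pt_old j
        · rw [hsingle i hi, Units.val_one, one_smul]; exact h.left_old i hi j
      · split_ifs with hi
        · subst hi; rw [hpt]; exact h.left_pt_new
        · rw [hsingle i hi, Units.val_one, one_smul]; exact h.left_new i hi
    · refine hright.2 ⟨fun i j => ?_, h.right_last_old, fun j => ?_, h.right_last_new⟩
      · split_ifs with hj
        · subst hj; rw [hpt]; exact h.right_pt_old i
        · rw [hsingle j hj, Units.val_one, one_smul]; exact h.right_old i j hj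
      · split_ifs with hj
        · subst hj; rw [hpt]; exact h.right_pt_new
        · rw [hsingle j hj, Units.val_one, one_smul]; exact h.right_new j hj

theorem solves_mulSingle_iff (B : BraidGroup n) (e : Fin (n + 1)) (g : RUVˣ) (f : A n →ₐ[RUV] S) :
    Solves B (Pi.mulSingle e g) f ↔
      ((∀ i ≠ e, ∀ j, (Ahat n).map f i j = ((PhiL B).map f * (Acheck n).map f) i j) ∧
        ∀ j, (Ahat n).map f e j = (g : RUV) • ((PhiL B).map f * (Acheck n).map f) e j) ∧
      ((∀ i, ∀ j ≠ e, (Acheck n).map f i j = ((Ahat n).map f * (PhiR B).map f) i j) ∧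
        ∀ i, (g : RUV) • (Acheck n).map f i e = ((Ahat n).map f * (PhiR B).map f) i e) := by
  have hg : (Pi.mulSingle e g : Fin (n + 1) → RUVˣ) e = g := Pi.mulSingle_eq_same _ _
  have h1 : ∀ i ≠ e, (Pi.mulSingle e g : Fin (n + 1) → RUVˣ) i = 1 := fun i hi =>
    Pi.mulSingle_eq_of_ne hi _
  constructor
  · intro h
    have hl := fun i j => congrFun (congrFun h.left i) j
    have hr := fun i j => congrFun (congrFun h.right i) j
    simp only [scalarDiag_mul_apply, mul_scalarDiag_apply] at hl hr
    refine ⟨⟨fun i hi j => ?_, fun j => ?_⟩, fun i j hj => ?_, fun i => ?_⟩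
    · rw [hl, h1 i hi, Units.val_one, one_smul]
    · rw [hl, hg]
    · rw [← hr, h1 j hj, Units.val_one, one_smul]
    · rw [← hr, hg]
  · rintro ⟨⟨hl, hl'⟩, hr, hr'⟩
    constructor
    · ext i j
      rw [scalarDiag_mul_apply]
      by_cases hi : i = e
      · rw [hi, hg, hl']
      · rw [h1 i hi, Units.val_one, one_smul, hl i hi]
    · ext i j
      rw [mul_scalarDiag_apply]
      by_cases hj : j = e
      · rw [hj, hg, hr']
      · rw [h1 j hj, Units.val_one, one_smul, hr i j hj]

/-- The relations of a positive stabilization eliminate the new generators and reduce to the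
relations of the original braid. -/
theorem solves_stab_iff (B : BraidGroup n) (d : RUVˣ) (f : A (n + 1) →ₐ[RUV] S) :
    Solves (addStrand B * sigma (Fin.last n)) (Pi.mulSingle (Fin.last n).castSucc d) f ↔
      Solves B (Pi.mulSingle (Fin.last n) (d * mu)) (f.comp incl) ∧
      (∀ i : Fin (n + 1), f (a i.castSucc (Fin.last _)) =
        (d : RUV) • f (incl (Acheck n i (Fin.last n)))) ∧
      ∀ j : Fin (n + 1), ((d * mu : RUVˣ) : RUV) • f (a (Fin.last _) j.castSucc) =
        f (incl (Ahat n (Fin.last n) j)) := by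
  rw [solves_stab_iff_stabRelations, solves_mulSingle_iff, stabRelations_iff]
  · exact and_assoc.symm
  · intro i hi
    have h := Fin.lt_last_iff_ne_last.2 hi
    simp only [Ahat_eq, Acheck_eq, Matrix.map_apply, genA_upper h, map_smul, smul_smul, mul_comm]
  · intro j hj
    have h := Fin.lt_last_iff_ne_last.2 hj
    simp only [Ahat_eq, Acheck_eq, Matrix.map_apply, genA_lower h, map_smul, one_smul]
  · rw [Ahat_eq, Matrix.map_apply, genA_diag, map_neg, AlgHom.commutes, add_comm,
      Algebra.algebraMap_eq_smul_one]
  · rw [Acheck_eq, Matrix.map_apply, genA_diag, map_neg, AlgHom.commutes, add_comm,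
      Algebra.algebraMap_eq_smul_one]

/-- The elimination of the generators of the last strand of a positive stabilization. -/
def destab (n : ℕ) (d : RUVˣ) : A (n + 1) →ₐ[RUV] A n :=
  FreeAlgebra.lift RUV fun p =>
    Fin.lastCases (motive := fun _ => A n)
      (Fin.lastCases (motive := fun _ => A n) 0
        (fun j => (((d * mu)⁻¹ : RUVˣ) : RUV) • Ahat n (Fin.last n) j) p.1.2)
      (fun i => Fin.lastCases (motive := fun _ => A n)
        ((d : RUV) • Acheck n i (Fin.last n)) (fun j => a i j) p.1.2) p.1.1

theorem destab_castSucc_castSucc (d : RUVˣ) {i j : Fin (n + 1)} (h : i ≠ j) :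
    destab n d (a i.castSucc j.castSucc) = a i j := by
  simp [destab, a, h]

theorem destab_castSucc_last (d : RUVˣ) (i : Fin (n + 1)) :
    destab n d (a i.castSucc (Fin.last _)) = (d : RUV) • Acheck n i (Fin.last n) := by
  simp [destab, a, i.castSucc_lt_last.ne]

theorem destab_last_castSucc (d : RUVˣ) (j : Fin (n + 1)) :
    destab n d (a (Fin.last _) j.castSucc) =
      (((d * mu)⁻¹ : RUVˣ) : RUV) • Ahat n (Fin.last n) j := by
  simp [destab, a, j.castSucc_lt_last.ne']

theorem destab_incl (d : RUVˣ) (x : A n) : destab n d (incl x) = x := by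
  have : (destab n d).comp incl = AlgHom.id RUV (A n) := by
    apply alg_hom_ext
    intro i j hij
    rw [AlgHom.comp_apply, incl_a _ _ hij, destab_castSucc_castSucc d hij, AlgHom.id_apply]
  exact DFunLike.congr_fun this x

theorem twistedHT_stab (B : BraidGroup n) (d : RUVˣ) :
    Nonempty (TwistedHT B (Pi.mulSingle (Fin.last n) (d * mu)) ≃ₐ[RUV]
      TwistedHT (addStrand B * sigma (Fin.last n)) (Pi.mulSingle (Fin.last n).castSucc d)) := by
  -- In the universal solution for the stabilized braid the new generators already have the values
  -- prescribed by `destab`, which is why `incl` after `destab` is the identity on the quotient.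
  obtain ⟨h1, h2, h3⟩ := (solves_stab_iff B d _).1 (solves_toHT _ _)
  refine nonempty_algEquiv incl (destab n d) h1 ((solves_stab_iff B d _).2 ⟨?_, ?_, ?_⟩)
    (fun i j hij => ?_) fun i j _ => by rw [destab_incl]
  · have : ((toHT B (Pi.mulSingle (Fin.last n) (d * mu))).comp (destab n d)).comp incl =
        toHT B (Pi.mulSingle (Fin.last n) (d * mu)) := by
      ext x
      simp [destab_incl]
    rw [this]
    exact solves_toHT _ _
  · intro i
    rw [AlgHom.comp_apply, AlgHom.comp_apply, destab_incl, destab_castSucc_last, map_smul]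
  · intro j
    rw [AlgHom.comp_apply, AlgHom.comp_apply, destab_incl, destab_last_castSucc, map_smul,
      smul_smul, Units.mul_inv, one_smul]
  · induction i using Fin.lastCases with
    | last =>
      induction j using Fin.lastCases with
      | last => exact absurd rfl hij
      | cast j =>
        apply units_smul_cancel (d * mu)
        rw [h3, destab_last_castSucc, map_smul, map_smul, smul_smul, Units.mul_inv, one_smul]
    | cast i =>
      induction j using Fin.lastCases with
      | last => rw [h2, destab_castSucc_last, map_smul, map_smul]
      | cast j =>
        have hij' : i ≠ j := fun h => hij (by rw [h])
        rw [destab_castSucc_castSucc d hij', incl_a _ _ hij']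

/-! ### Invariance -/

/-- A map that sends each step of `π` into one cycle of `ρ` sends cycles into cycles. It serves for
the inclusion of the old strands and for the map that collapses the new strand onto its neighbour.
-/
theorem sameCycle_map {α β : Type*} [Finite α] {π : Equiv.Perm α} {ρ : Equiv.Perm β} (r : α → β)
    (h : ∀ x, ρ.SameCycle (r x) (r (π x))) {x y : α} (hxy : π.SameCycle x y) :
    ρ.SameCycle (r x) (r y) := by
  obtain ⟨k, rfl⟩ := hxy.exists_nat_pow_eq
  induction k with
  | zero => exact .refl _ _
  | succ k ih =>
    rw [pow_succ', Equiv.Perm.mul_apply]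
    exact (ih ⟨k, by simp⟩).trans (h _)

theorem braidPerm_addStrand (B : BraidGroup n) :
    (∀ i, braidPerm (addStrand B) i.castSucc = (braidPerm B i).castSucc) ∧
      braidPerm (addStrand B) (Fin.last _) = Fin.last _ := by
  induction B using braid_group_induction with
  | h1 => simp
  | hs k =>
    rw [addStrand_sigma, braidPerm_sigma, braidPerm_sigma, Fin.succ_castSucc]
    refine ⟨fun i => ?_, Equiv.swap_apply_of_ne_of_ne (Fin.castSucc_lt_last _).ne'
      (Fin.castSucc_lt_last _).ne'⟩
    simp only [Equiv.swap_apply_def, Fin.castSucc_inj]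
    split_ifs <;> rfl
  | hmul B C hB hC =>
    simp [hB, hC]
  | hinv B hB =>
    simp only [map_inv, Equiv.Perm.inv_eq_iff_eq]
    exact ⟨fun i => by simp [hB.1], hB.2.symm⟩

theorem closureIsKnot_conj (B C : BraidGroup n) :
    ClosureIsKnot B ↔ ClosureIsKnot (C⁻¹ * B * C) := by
  have key : ∀ B C : BraidGroup n, ClosureIsKnot B → ClosureIsKnot (C * B * C⁻¹) := by
    intro B C h i j
    rw [map_mul, map_mul, map_inv, Equiv.Perm.sameCycle_conj]
    exact h _ _
  refine ⟨fun h => by simpa using key B C⁻¹ h, fun h => ?_⟩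
  have := key _ C h
  rwa [show C * (C⁻¹ * B * C) * C⁻¹ = B by group] at this

/-- Stabilization inserts the new strand into the cycle of the last old strand, directly after it,
and changes no other cycle. -/
theorem closureIsKnot_stab (B : BraidGroup n) :
    ClosureIsKnot B ↔ ClosureIsKnot (addStrand B * sigma (Fin.last n)) := by
  set ρ := braidPerm (addStrand B * sigma (Fin.last n)) with hρ
  have hρ' : ρ = braidPerm (addStrand B) *
      Equiv.swap (Fin.last n).castSucc (Fin.last (n + 1)) := by
    rw [hρ, map_mul, braidPerm_sigma, Fin.succ_last]
  have h1 : ∀ i ≠ Fin.last n, ρ i.castSucc = (braidPerm B i).castSucc := fun i hi => by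
    rw [hρ', Equiv.Perm.mul_apply, Equiv.swap_apply_of_ne_of_ne (by simpa using hi)
      i.castSucc_lt_last.ne, (braidPerm_addStrand B).1]
  have h2 : ρ (Fin.last n).castSucc = Fin.last (n + 1) := by
    rw [hρ', Equiv.Perm.mul_apply, Equiv.swap_apply_left, (braidPerm_addStrand B).2]
  have h3 : ρ (Fin.last (n + 1)) = (braidPerm B (Fin.last n)).castSucc := by
    rw [hρ', Equiv.Perm.mul_apply, Equiv.swap_apply_right, (braidPerm_addStrand B).1]
  constructor
  · intro h
    have step : ∀ i, ρ.SameCycle (Fin.castSucc i) (braidPerm B i).castSucc := by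
      intro i
      by_cases hi : i = Fin.last n
      -- The last old strand reaches its former image in two steps, through the new strand.
      · exact ⟨2, by rw [hi]; simp [zpow_ofNat, pow_two, h2, h3]⟩
      · exact ⟨1, by simp [h1 i hi]⟩
    have hl : ∀ x, ∃ i : Fin (n + 1), ρ.SameCycle i.castSucc x := fun x => by
      induction x using Fin.lastCases with
      | last => exact ⟨Fin.last n, 1, by simp [h2]⟩
      | cast i => exact ⟨i, .refl _ _⟩
    intro x y
    obtain ⟨i, hi⟩ := hl x
    obtain ⟨j, hj⟩ := hl y
    exact (hi.symm.trans (sameCycle_map Fin.castSucc step (h i j))).trans hj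
  · intro h i j
    let r : Fin (n + 2) → Fin (n + 1) := Fin.lastCases (motive := fun _ => Fin (n + 1))
      (Fin.last n) id
    have hr : ∀ i : Fin (n + 1), r i.castSucc = i := fun i => by simp [r]
    have hr' : r (Fin.last _) = Fin.last n := by simp [r]
    have := sameCycle_map (π := ρ) (ρ := braidPerm B) r (fun x => ?_) (h i.castSucc j.castSucc)
    · rwa [hr, hr] at this
    · induction x using Fin.lastCases with
      | last => rw [h3, hr, hr']; exact ⟨1, by simp⟩
      | cast i =>
        by_cases hi : i = Fin.last n
        · rw [hi, h2, hr, hr']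
        · rw [h1 i hi, hr, hr]; exact ⟨1, by simp⟩

theorem writhe_addStrand (B : BraidGroup n) : writheHom (addStrand B) = writheHom B := by
  induction B using braid_group_induction with
  | h1 => simp
  | hs k => rw [addStrand_sigma]; simp only [writheHom, braidLift_sigma]
  | hmul B C hB hC => simp [hB, hC]
  | hinv B hB => simp [hB]

theorem writhe_stab (B : BraidGroup n) :
    writhe (addStrand B * sigma (Fin.last n)) = writhe B + 1 := by
  rw [writhe, map_mul, writhe_addStrand, toAdd_mul]
  congr 1

theorem writhe_conj (B C : BraidGroup n) : writhe (C⁻¹ * B * C) = writhe B := by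
  simp [writhe]

theorem nonempty_HTminusZero_equiv (B : BraidGroup n) :
    Nonempty (HTminusZero B ≃ₐ[RUV]
      TwistedHT B (Pi.mulSingle 0 (lam * mu ^ (-writhe B)))) := by
  have h : lamEntry B = Pi.mulSingle 0 (lam * mu ^ (-writhe B)) := by
    ext i : 1
    rw [lamEntry, Pi.mulSingle_apply]
  have e : HTRel B = TwistedRel B (lamEntry B) := by
    funext x y
    apply propext
    constructor
    · rintro (⟨i, j⟩ | ⟨i, j⟩)
      exacts [.left i j, .right i j]
    · rintro (⟨i, j⟩ | ⟨i, j⟩)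
      exacts [.left i j, .right i j]
  change Nonempty (RingQuot (HTRel B) ≃ₐ[RUV] _)
  rw [e, h]
  exact ⟨AlgEquiv.refl⟩

theorem nonempty_equiv_conj {B : BraidGroup n} (hB : ClosureIsKnot B) (C : BraidGroup n) :
    Nonempty (HTminusZero B ≃ₐ[RUV] HTminusZero (C⁻¹ * B * C)) := by
  set g := lam * mu ^ (-writhe B)
  obtain ⟨e1⟩ := nonempty_HTminusZero_equiv B
  -- Conjugation permutes the entries of `D`, so the nontrivial one is first moved to the strand
  -- that conjugation returns to `0`.
  obtain ⟨e2⟩ := twistedHT_mulSingle_of_isKnot hB 0 (braidPerm C 0) g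
  obtain ⟨e3⟩ := twistedHT_conj B C (Pi.mulSingle (braidPerm C 0) g)
  obtain ⟨e4⟩ := nonempty_HTminusZero_equiv (C⁻¹ * B * C)
  have h : (Pi.mulSingle (braidPerm C 0) g : Fin (n + 1) → RUVˣ) ∘ braidPerm C =
      Pi.mulSingle 0 g := by
    ext i
    simp [Pi.mulSingle_apply]
  rw [h] at e3
  rw [writhe_conj] at e4
  exact ⟨((e1.trans e2).trans e3).trans e4.symm⟩

theorem nonempty_equiv_stab {B : BraidGroup n} (hB : ClosureIsKnot B) :
    Nonempty (HTminusZero B ≃ₐ[RUV] HTminusZero (addStrand B * sigma (Fin.last n))) := by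
  -- This is the entry of `Λ` for the stabilized braid, of writhe `w(B) + 1`; hence `d μ` is the
  -- entry for `B`.
  set d := lam * mu ^ (-(writhe B + 1)) with hd
  have hg : lam * mu ^ (-writhe B) = d * mu := by
    rw [hd, mul_assoc, ← zpow_add_one, neg_add, neg_add_cancel_right]
  obtain ⟨e1⟩ := nonempty_HTminusZero_equiv B
  obtain ⟨e2⟩ := twistedHT_mulSingle_of_isKnot hB 0 (Fin.last n) (lam * mu ^ (-writhe B))
  obtain ⟨e3⟩ := twistedHT_stab B d
  -- Returning the entry to strand `0` requires the stabilized closure to be a knot as well.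
  obtain ⟨e4⟩ := twistedHT_mulSingle_of_isKnot ((closureIsKnot_stab B).1 hB)
    (Fin.last n).castSucc 0 d
  obtain ⟨e5⟩ := nonempty_HTminusZero_equiv (addStrand B * sigma (Fin.last n))
  rw [writhe_stab] at e5
  rw [hg] at e1 e2
  exact ⟨(((e1.trans e2).trans e3).trans e4).trans e5.symm⟩

/-- The knot condition is carried along as an equivalence, since reversing a move needs it for the
other braid and composing moves needs it for the intermediate one. -/
theorem transverseEquiv_invariance {x y : Braid} (h : TransverseEquiv x y) :
    (ClosureIsKnot x.2 ↔ ClosureIsKnot y.2) ∧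
      (ClosureIsKnot x.2 → Nonempty (HTminusZero x.2 ≃ₐ[RUV] HTminusZero y.2)) := by
  induction h with
  | rel x y h =>
    cases h with
    | conj B g => exact ⟨closureIsKnot_conj B g, fun hB => nonempty_equiv_conj hB g⟩
    | stab B => exact ⟨closureIsKnot_stab B, fun hB => nonempty_equiv_stab hB⟩
  | refl x => exact ⟨Iff.rfl, fun _ => ⟨AlgEquiv.refl⟩⟩
  | symm x y _ ih =>
    exact ⟨ih.1.symm, fun h => (ih.2 (ih.1.2 h)).map AlgEquiv.symm⟩
  | trans x y z _ _ ih1 ih2 =>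
    refine ⟨ih1.1.trans ih2.1, fun h => ?_⟩
    obtain ⟨e1⟩ := ih1.2 h
    obtain ⟨e2⟩ := ih2.2 (ih1.1.1 h)
    exact ⟨e1.trans e2⟩

end TransverseHomology

end

theorem proposition3p4 {n m : ℕ} (B : TransverseHomology.BraidGroup n)
    (B' : TransverseHomology.BraidGroup m) (hB : TransverseHomology.ClosureIsKnot B)
    (h : TransverseHomology.TransverseEquiv ⟨n, B⟩ ⟨m, B'⟩) :
    Nonempty (TransverseHomology.HTminusZero B ≃ₐ[TransverseHomology.RUV]
      TransverseHomology.HTminusZero B') :=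
  (TransverseHomology.transverseEquiv_invariance h).2 hB
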